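/- Let $\mathcal K$ be a bicategory, with horizontal composition $\otimes$ (coherence isomorphisms are omitted, and $f\otimes g$ means first $g$, then $f$), in which idempotent 2-cells split. All monads are associative and unital, with multiplication $\mu$ and unit $\eta$. A monad morphism (in the sense of Street) from $A$ to $A'$ is a 1-cell $V$ with a 2-cell $\xi:A'\otimes V\to V\otimes A$ such that $\xi(\mu_{A'}\otimes V)=(V\otimes\mu_A)(\xi\otimes A)(A'\otimes\xi)$ and $\xi(\eta_{A'}\otimes V)=V\otimes\eta_A$. A monad transformation $(V,\xi)\to(V',\xi')$ is a 2-cell $\omega:V\to V'$ with $(\omega\otimes A)\xi=\xi'(A'\otimes\omega)$. *Weak distributive laws.* A weak distributive law consists of monads $A,B$ on the same object and a 2-cell $\Psi:A\otimes B\to B\otimes A$ such that $$\Psi(\mu_A\otimes B)=(B\otimes\mu_A)(\Psi\otimes A)(A\otimes\Psi),\qquad \Psi(A\otimes\mu_B)=(\mu_B\otimes A)(B\otimes\Psi)(\Psi\otimes B),$$ $$(\mu_B\otimes A)(B\otimes\Psi)(B\otimes A\otimes\eta_B)=(B\otimes\mu_A)(\Psi\otimes A)(\eta_A\otimes B\otimes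 A).$$ Put $\overline\Psi:=(\mu_B\otimes\mu_A)(B\otimes\Psi\otimes A)(B\otimes\eta_A\otimes\eta_B\otimes A):B\otimes A\to B\otimes A$. The bicategory $\mathsf{Wdl}(\mathcal K)$ has the weak distributive laws in $\mathcal K$ as 0-cells. Its 1-cells from $\Psi$ to $\Psi'$ are pairs of monad morphisms $\xi:A'\otimes V\to V\otimes A$ and $\zeta:B'\otimes V\to V\otimes B$ with a common 1-cell $V$ such that $$(V\otimes\Psi)(\xi\otimes B)(A'\otimes\zeta)=(V\otimes\overline\Psi)(\zeta\otimes A)(B'\otimes\xi)(\Psi'\otimes V).$$ Its 2-cells are the 2-cells $V\to V'$ of $\mathcal K$ that are monad transformations $(V,\xi)\to(V',\xi')$ and $(V,\zeta)\to(V',\zeta')$. Compositions are induced by those of $\mathcal K$. *Bilinear factorization structures.* A bilinear factorization structure consists of monads $A,B,R$ on the same object, 2-cells $\alpha:A\to R\leftarrow B:\beta$ compatible with the multiplications and units, and a 2-cell $\iota:R\to B\otimes A$ which is a section of $\pi:=\mu_R(\beta\otimes\alpha):B\otimes A\to R$, that is, $\pi\iota=R$, and a homomorphism of $B$-$A$ bimodules,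 where $B$ acts on $R$ by $\mu_R(\beta\otimes R)$ and $A$ by $\mu_R(R\otimes\alpha)$. The bicategory $\mathsf{Bf}(\mathcal K)$ has these as 0-cells. Its 1-cells from $(\alpha,\beta,\iota)$ to $(\alpha',\beta',\iota')$ are triples of monad morphisms $\xi:A'\otimes V\to V\otimes A$, $\zeta:B'\otimes V\to V\otimes B$ and $\varrho:R'\otimes V\to V\otimes R$ with a common 1-cell $V$ such that $\varrho(\alpha'\otimes V)=(V\otimes\alpha)\xi$ and $\varrho(\beta'\otimes V)=(V\otimes\beta)\zeta$. Its 2-cells are the 2-cells $V\to V'$ of $\mathcal K$ that are monad transformations for all three. Compositions are induced by those of $\mathcal K$. *Theorem.* Let $F:\mathsf{Bf}(\mathcal K)\to\mathsf{Wdl}(\mathcal K)$ be the pseudofunctor that sends $(\alpha,\beta,\iota)$ to the weak distributive law $\Psi:=\iota\mu_R(\alpha\otimes\beta)$, sends a 1-cell $(\xi,\zeta,\varrho)$ to $(\xi,\zeta)$, and is the identity on 2-cells. Then $F$ is a biequivalence: every 0-cell of $\mathsf{Wdl}(\mathcal K)$ is equivalent in $\mathsf{Wdl}(\mathcal K)$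 to one of the form $F(X)$, and for all 0-cells $X,Y$ of $\mathsf{Bf}(\mathcal K)$ the functor $\mathsf{Bf}(\mathcal K)(X,Y)\to\mathsf{Wdl}(\mathcal K)(FX,FY)$ induced by $F$ is an equivalence of categories. -/

import Mathlib

open CategoryTheory CategoryTheory.Bicategory

universe w v u

/-
Convention. The horizontal composition `f ⊗ g` of the literature on monads (first `g`, then `f`)
is `g ≫ f` here. So `η ▷ g` is the 2-cell `g ⊗ η` and `f ◁ η` is the 2-cell `η ⊗ f`; in
particular `A ⊗ B` is `B.t ≫ A.t`, and `A' ⊗ V ⟶ V ⊗ A` is `V ≫ A'.t ⟶ A.t ≫ V`.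
-/

namespace BilinFac

variable {K : Type u} [Bicategory.{w, v} K]

/-- An (associative and unital) monad on the object `X` of a bicategory. -/
structure BMonad (X : K) where
  t : X ⟶ X
  mul : t ≫ t ⟶ t
  unit : 𝟙 X ⟶ t
  assoc : mul ▷ t ≫ mul = (α_ t t t).hom ≫ t ◁ mul ≫ mul
  unit_left : unit ▷ t ≫ mul = (λ_ t).hom
  unit_right : t ◁ unit ≫ mul = (ρ_ t).hom

/-- The 2-cell `A' ⊗ V ⟶ V ⊗ A` of a monad morphism with underlying 1-cell `V`, in the sense of
Street (The formal theory of monads), from the monad `A` on `X` to the monad `A'` on `X'`. -/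
@[ext]
structure MonadHom {X X' : K} (A : BMonad X) (A' : BMonad X') (V : X ⟶ X') where
  cell : V ≫ A'.t ⟶ A.t ≫ V
  unit : (ρ_ V).inv ≫ V ◁ A'.unit ≫ cell = (λ_ V).inv ≫ A.unit ▷ V
  mul : V ◁ A'.mul ≫ cell =
    (α_ V A'.t A'.t).inv ≫ cell ▷ A'.t ≫ (α_ A.t V A'.t).hom ≫ A.t ◁ cell ≫
      (α_ A.t A.t V).inv ≫ A.mul ▷ V

namespace MonadHom

/-- The identity monad morphism. -/
def id {X : K} (A : BMonad X) : MonadHom A A (𝟙 X) where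
  cell := (λ_ A.t).hom ≫ (ρ_ A.t).inv
  unit := by bicategory
  mul := by bicategory

/-- The composite of monad morphisms, with 2-cell
`A'' ⊗ W ⊗ V ⟶ W ⊗ A' ⊗ V ⟶ W ⊗ V ⊗ A`. -/
def comp {X X' X'' : K} {A : BMonad X} {A' : BMonad X'} {A'' : BMonad X''}
    {V : X ⟶ X'} {W : X' ⟶ X''} (x : MonadHom A A' V) (y : MonadHom A' A'' W) :
    MonadHom A A'' (V ≫ W) where
  cell := (α_ V W A''.t).hom ≫ V ◁ y.cell ≫ (α_ V A'.t W).inv ≫ x.cell ▷ W ≫ (α_ A.t V W).hom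
  unit := by
    calc
      _ = 𝟙 _ ⊗≫ V ◁ ((ρ_ W).inv ≫ W ◁ A''.unit ≫ y.cell) ⊗≫ x.cell ▷ W ⊗≫ 𝟙 _ := by bicategory
      _ = 𝟙 _ ⊗≫ ((ρ_ V).inv ≫ V ◁ A'.unit ≫ x.cell) ▷ W ⊗≫ 𝟙 _ := by
        rw [y.unit]; bicategory
      _ = _ := by rw [x.unit]; bicategory
  mul := by
    calc
      _ = 𝟙 _ ⊗≫ V ◁ (W ◁ A''.mul ≫ y.cell) ⊗≫ x.cell ▷ W ⊗≫ 𝟙 _ := by bicategory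
      _ = 𝟙 _ ⊗≫ V ◁ y.cell ▷ A''.t ⊗≫ V ◁ A'.t ◁ y.cell ⊗≫ (V ◁ A'.mul ≫ x.cell) ▷ W ⊗≫ 𝟙 _ := by
        rw [y.mul]; bicategory
      _ = 𝟙 _ ⊗≫ V ◁ y.cell ▷ A''.t ⊗≫ ((V ≫ A'.t) ◁ y.cell ≫ x.cell ▷ (A'.t ≫ W)) ⊗≫
            A.t ◁ x.cell ▷ W ⊗≫ A.mul ▷ (V ≫ W) := by
        rw [x.mul]; bicategory
      _ = _ := by rw [whisker_exchange]; bicategory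

end MonadHom

/-- `ω` is a monad transformation from `(V, x)` to `(V', x')`, in the sense of Street:
`(ω ⊗ A) x = x' (A' ⊗ ω)`. -/
def IsMonadTrans {X X' : K} {A : BMonad X} {A' : BMonad X'} {V V' : X ⟶ X'}
    (x : MonadHom A A' V) (x' : MonadHom A A' V') (ω : V ⟶ V') : Prop :=
  x.cell ≫ A.t ◁ ω = ω ▷ A'.t ≫ x'.cell

namespace IsMonadTrans
section
variable {X X' : K} {A : BMonad X} {A' : BMonad X'} {U V W : X ⟶ X'}

lemma id (x : MonadHom A A' V) : IsMonadTrans x x (𝟙 V) := by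
  simp [IsMonadTrans]

lemma comp {x : MonadHom A A' U} {y : MonadHom A A' V} {z : MonadHom A A' W}
    {ω : U ⟶ V} {θ : V ⟶ W} (h : IsMonadTrans x y ω) (k : IsMonadTrans y z θ) :
    IsMonadTrans x z (ω ≫ θ) := by
  unfold IsMonadTrans at *
  rw [whiskerLeft_comp, reassoc_of% h, k, comp_whiskerRight, Category.assoc]

lemma inv {x : MonadHom A A' U} {y : MonadHom A A' V} {ω : U ≅ V}
    (h : IsMonadTrans x y ω.hom) : IsMonadTrans y x ω.inv := by
  unfold IsMonadTrans at *
  rw [← cancel_epi (ω.hom ▷ A'.t), ← reassoc_of% h]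
  simp [← Bicategory.whiskerLeft_comp]
end

section
variable {X X' X'' X₃ : K} {A : BMonad X} {A' : BMonad X'} {A'' : BMonad X''} {A₃ : BMonad X₃}

lemma whiskerLeft {V : X ⟶ X'} {W W' : X' ⟶ X''} (x : MonadHom A A' V)
    {y : MonadHom A' A'' W} {y' : MonadHom A' A'' W'} {ω : W ⟶ W'} (h : IsMonadTrans y y' ω) :
    IsMonadTrans (x.comp y) (x.comp y') (V ◁ ω) := by
  unfold IsMonadTrans at *
  dsimp only [MonadHom.comp]
  calc
    _ = 𝟙 _ ⊗≫ V ◁ y.cell ⊗≫ (x.cell ▷ W ≫ (A.t ≫ V) ◁ ω) ⊗≫ 𝟙 _ := by bicategory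
    _ = 𝟙 _ ⊗≫ V ◁ (y.cell ≫ A'.t ◁ ω) ⊗≫ x.cell ▷ W' ⊗≫ 𝟙 _ := by
      rw [← whisker_exchange]; bicategory
    _ = _ := by rw [h]; bicategory

lemma whiskerRight {V V' : X ⟶ X'} {W : X' ⟶ X''} {x : MonadHom A A' V} {x' : MonadHom A A' V'}
    (y : MonadHom A' A'' W) {ω : V ⟶ V'} (h : IsMonadTrans x x' ω) :
    IsMonadTrans (x.comp y) (x'.comp y) (ω ▷ W) := by
  unfold IsMonadTrans at *
  dsimp only [MonadHom.comp]
  calc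
    _ = 𝟙 _ ⊗≫ V ◁ y.cell ⊗≫ (x.cell ≫ A.t ◁ ω) ▷ W ⊗≫ 𝟙 _ := by bicategory
    _ = 𝟙 _ ⊗≫ (V ◁ y.cell ≫ ω ▷ (A'.t ≫ W)) ⊗≫ x'.cell ▷ W ⊗≫ 𝟙 _ := by
      rw [h]; bicategory
    _ = _ := by rw [whisker_exchange]; bicategory

lemma associator {U : X ⟶ X'} {V : X' ⟶ X''} {W : X'' ⟶ X₃} (x : MonadHom A A' U)
    (y : MonadHom A' A'' V) (z : MonadHom A'' A₃ W) :
    IsMonadTrans ((x.comp y).comp z) (x.comp (y.comp z)) (α_ U V W).hom := by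
  unfold IsMonadTrans
  dsimp only [MonadHom.comp]
  bicategory

lemma leftUnitor {V : X ⟶ X'} (x : MonadHom A A' V) :
    IsMonadTrans ((MonadHom.id A).comp x) x (λ_ V).hom := by
  unfold IsMonadTrans
  dsimp only [MonadHom.comp, MonadHom.id]
  bicategory

lemma rightUnitor {V : X ⟶ X'} (x : MonadHom A A' V) :
    IsMonadTrans (x.comp (MonadHom.id A')) x (ρ_ V).hom := by
  unfold IsMonadTrans
  dsimp only [MonadHom.comp, MonadHom.id]
  bicategory
end
end IsMonadTrans

/-- `Ψ : A ⊗ B ⟶ B ⊗ A` is a weak distributive law of `A` over `B`: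
* `mul_left`: `Ψ (μ ⊗ B) = (B ⊗ μ) (Ψ ⊗ A) (A ⊗ Ψ)`;
* `mul_right`: `Ψ (A ⊗ μ) = (μ ⊗ A) (B ⊗ Ψ) (Ψ ⊗ B)`;
* `unit`: `(μ ⊗ A) (B ⊗ Ψ) (B ⊗ A ⊗ η) = (B ⊗ μ) (Ψ ⊗ A) (η ⊗ B ⊗ A)`. -/
structure IsWeakDistribLaw {X : K} (A B : BMonad X) (Ψ : B.t ≫ A.t ⟶ A.t ≫ B.t) : Prop where
  mul_left : B.t ◁ A.mul ≫ Ψ =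
    (α_ B.t A.t A.t).inv ≫ Ψ ▷ A.t ≫ (α_ A.t B.t A.t).hom ≫ A.t ◁ Ψ ≫
      (α_ A.t A.t B.t).inv ≫ A.mul ▷ B.t
  mul_right : B.mul ▷ A.t ≫ Ψ =
    (α_ B.t B.t A.t).hom ≫ B.t ◁ Ψ ≫ (α_ B.t A.t B.t).inv ≫ Ψ ▷ B.t ≫
      (α_ A.t B.t B.t).hom ≫ A.t ◁ B.mul
  unit : (λ_ (A.t ≫ B.t)).inv ≫ B.unit ▷ (A.t ≫ B.t) ≫ (α_ B.t A.t B.t).inv ≫ Ψ ▷ B.t ≫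
      (α_ A.t B.t B.t).hom ≫ A.t ◁ B.mul =
    (ρ_ (A.t ≫ B.t)).inv ≫ (A.t ≫ B.t) ◁ A.unit ≫ (α_ A.t B.t A.t).hom ≫ A.t ◁ Ψ ≫
      (α_ A.t A.t B.t).inv ≫ A.mul ▷ B.t

/-- The multiplication `(μ ⊗ μ) (B ⊗ Ψ ⊗ A) : B ⊗ A ⊗ B ⊗ A ⟶ B ⊗ A`. -/
def wreathMul {X : K} (A B : BMonad X) (Ψ : B.t ≫ A.t ⟶ A.t ≫ B.t) :
    (A.t ≫ B.t) ≫ (A.t ≫ B.t) ⟶ A.t ≫ B.t :=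
  (α_ A.t B.t (A.t ≫ B.t)).hom ≫ A.t ◁ (α_ B.t A.t B.t).inv ≫ A.t ◁ Ψ ▷ B.t ≫
    A.t ◁ (α_ A.t B.t B.t).hom ≫ (α_ A.t A.t (B.t ≫ B.t)).inv ≫
      A.mul ▷ (B.t ≫ B.t) ≫ A.t ◁ B.mul

/-- The 2-cell `B ⊗ A ⟶ B ⊗ A` obtained by composing `B ⊗ η_A ⊗ η_B ⊗ A` with `wreathMul`
(an idempotent if `Ψ` is a weak distributive law). -/
def bar {X : K} (A B : BMonad X) (Ψ : B.t ≫ A.t ⟶ A.t ≫ B.t) :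
    A.t ≫ B.t ⟶ A.t ≫ B.t :=
  ((ρ_ A.t).inv ▷ B.t ≫ (A.t ≫ 𝟙 X) ◁ (λ_ B.t).inv) ≫
    ((A.t ◁ B.unit) ▷ (𝟙 X ≫ B.t) ≫ (A.t ≫ B.t) ◁ (A.unit ▷ B.t)) ≫ wreathMul A B Ψ

section
variable {X : K} {A B : BMonad X} {Ψ : B.t ≫ A.t ⟶ A.t ≫ B.t}

lemma bar_eq (h : IsWeakDistribLaw A B Ψ) : bar A B Ψ =
    (λ_ (A.t ≫ B.t)).inv ≫ B.unit ▷ (A.t ≫ B.t) ≫ (α_ B.t A.t B.t).inv ≫ Ψ ▷ B.t ≫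
      (α_ A.t B.t B.t).hom ≫ A.t ◁ B.mul := by
  unfold bar wreathMul
  calc
    _ = 𝟙 _ ⊗≫ A.t ◁ B.unit ▷ B.t ⊗≫
          ((ρ_ (A.t ≫ B.t)).inv ≫ (A.t ≫ B.t) ◁ A.unit ≫ (α_ A.t B.t A.t).hom ≫ A.t ◁ Ψ ≫
            (α_ A.t A.t B.t).inv ≫ A.mul ▷ B.t) ▷ B.t ⊗≫ A.t ◁ B.mul := by bicategory
    _ = 𝟙 _ ⊗≫ (𝟙 X ◁ (A.t ◁ B.unit ▷ B.t) ≫ B.unit ▷ (A.t ≫ B.t ≫ B.t)) ⊗≫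
          Ψ ▷ B.t ▷ B.t ⊗≫ A.t ◁ (B.mul ▷ B.t ≫ B.mul) := by
      rw [← h.unit]; bicategory
    _ = 𝟙 _ ⊗≫ B.unit ▷ (A.t ≫ B.t) ⊗≫
          ((B.t ≫ A.t) ◁ (B.unit ▷ B.t) ≫ Ψ ▷ (B.t ≫ B.t)) ⊗≫
          A.t ◁ B.t ◁ B.mul ⊗≫ A.t ◁ B.mul := by
      rw [B.assoc, whisker_exchange]; bicategory
    _ = 𝟙 _ ⊗≫ B.unit ▷ (A.t ≫ B.t) ⊗≫ Ψ ▷ B.t ⊗≫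
          A.t ◁ B.t ◁ (B.unit ▷ B.t ≫ B.mul) ⊗≫ A.t ◁ B.mul := by
      rw [whisker_exchange]; bicategory
    _ = _ := by rw [B.unit_left]; bicategory

lemma comp_bar (h : IsWeakDistribLaw A B Ψ) : Ψ ≫ bar A B Ψ = Ψ := by
  rw [bar_eq h]
  calc
    _ = 𝟙 _ ⊗≫ (𝟙 X ◁ Ψ ≫ B.unit ▷ (A.t ≫ B.t)) ⊗≫ Ψ ▷ B.t ⊗≫ A.t ◁ B.mul := by bicategory
    _ = 𝟙 _ ⊗≫ B.unit ▷ B.t ▷ A.t ⊗≫ (B.mul ▷ A.t ≫ Ψ) := by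
      rw [whisker_exchange, h.mul_right]; bicategory
    _ = 𝟙 _ ⊗≫ (B.unit ▷ B.t ≫ B.mul) ▷ A.t ⊗≫ Ψ := by bicategory
    _ = _ := by rw [B.unit_left]; bicategory

lemma bar_linear (h : IsWeakDistribLaw A B Ψ) :
    A.t ◁ B.mul ≫ bar A B Ψ =
      (α_ A.t B.t B.t).inv ≫ bar A B Ψ ▷ B.t ≫ (α_ A.t B.t B.t).hom ≫ A.t ◁ B.mul := by
  rw [bar_eq h]
  calc
    _ = 𝟙 _ ⊗≫ (𝟙 X ◁ (A.t ◁ B.mul) ≫ B.unit ▷ (A.t ≫ B.t)) ⊗≫ Ψ ▷ B.t ⊗≫ A.t ◁ B.mul := by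
      bicategory
    _ = 𝟙 _ ⊗≫ B.unit ▷ (A.t ≫ B.t ≫ B.t) ⊗≫ ((B.t ≫ A.t) ◁ B.mul ≫ Ψ ▷ B.t) ⊗≫
          A.t ◁ B.mul := by
      rw [whisker_exchange]; bicategory
    _ = 𝟙 _ ⊗≫ B.unit ▷ (A.t ≫ B.t ≫ B.t) ⊗≫ Ψ ▷ (B.t ≫ B.t) ⊗≫
          A.t ◁ ((α_ B.t B.t B.t).hom ≫ B.t ◁ B.mul ≫ B.mul) := by
      rw [whisker_exchange]; bicategory
    _ = _ := by rw [← B.assoc]; bicategory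
end

/-- Compatibility of monad morphisms `ξ : A' ⊗ V ⟶ V ⊗ A` and `ζ : B' ⊗ V ⟶ V ⊗ B` with `Ψ` and
`Ψ'`: `(V ⊗ Ψ) (ξ ⊗ B) (A' ⊗ ζ) = (V ⊗ bar Ψ) (ζ ⊗ A) (B' ⊗ ξ) (Ψ' ⊗ V)`. -/
def IsWdlHom {X X' : K} {A B : BMonad X} {A' B' : BMonad X'} (Ψ : B.t ≫ A.t ⟶ A.t ≫ B.t)
    (Ψ' : B'.t ≫ A'.t ⟶ A'.t ≫ B'.t) {V : X ⟶ X'}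
    (ξ : MonadHom A A' V) (ζ : MonadHom B B' V) : Prop :=
  (α_ V B'.t A'.t).inv ≫ ζ.cell ▷ A'.t ≫ (α_ B.t V A'.t).hom ≫ B.t ◁ ξ.cell ≫
      (α_ B.t A.t V).inv ≫ Ψ ▷ V =
    V ◁ Ψ' ≫ (α_ V A'.t B'.t).inv ≫ ξ.cell ▷ B'.t ≫ (α_ A.t V B'.t).hom ≫ A.t ◁ ζ.cell ≫
      (α_ A.t B.t V).inv ≫ bar A B Ψ ▷ V

lemma IsWdlHom.id {X : K} {A B : BMonad X} {Ψ : B.t ≫ A.t ⟶ A.t ≫ B.t}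
    (h : IsWeakDistribLaw A B Ψ) : IsWdlHom Ψ Ψ (MonadHom.id A) (MonadHom.id B) := by
  unfold IsWdlHom
  dsimp only [MonadHom.id]
  calc
    _ = 𝟙 _ ⊗≫ Ψ ⊗≫ 𝟙 _ := by bicategory
    _ = 𝟙 _ ⊗≫ (Ψ ≫ bar A B Ψ) ⊗≫ 𝟙 _ := by rw [comp_bar h]
    _ = _ := by bicategory

lemma IsWdlHom.absorb {X X' : K} {A B : BMonad X} {A' B' : BMonad X'}
    {Ψ : B.t ≫ A.t ⟶ A.t ≫ B.t} {Ψ' : B'.t ≫ A'.t ⟶ A'.t ≫ B'.t} {V : X ⟶ X'}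
    {ξ : MonadHom A A' V} {ζ : MonadHom B B' V}
    (h : IsWeakDistribLaw A B Ψ) (h' : IsWeakDistribLaw A' B' Ψ') (H : IsWdlHom Ψ Ψ' ξ ζ) :
    V ◁ bar A' B' Ψ' ≫ (α_ V A'.t B'.t).inv ≫ ξ.cell ▷ B'.t ≫ (α_ A.t V B'.t).hom ≫
        A.t ◁ ζ.cell ≫ (α_ A.t B.t V).inv ≫ bar A B Ψ ▷ V =
      (α_ V A'.t B'.t).inv ≫ ξ.cell ▷ B'.t ≫ (α_ A.t V B'.t).hom ≫
        A.t ◁ ζ.cell ≫ (α_ A.t B.t V).inv ≫ bar A B Ψ ▷ V := by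
  unfold IsWdlHom at H
  calc
    _ = 𝟙 _ ⊗≫ V ◁ B'.unit ▷ (A'.t ≫ B'.t) ⊗≫ V ◁ Ψ' ▷ B'.t ⊗≫
          ((V ≫ A'.t) ◁ B'.mul ≫ ξ.cell ▷ B'.t) ⊗≫
          A.t ◁ ζ.cell ⊗≫ bar A B Ψ ▷ V := by
      rw [bar_eq h']; bicategory
    _ = 𝟙 _ ⊗≫ V ◁ B'.unit ▷ (A'.t ≫ B'.t) ⊗≫ V ◁ Ψ' ▷ B'.t ⊗≫
          ξ.cell ▷ (B'.t ≫ B'.t) ⊗≫ A.t ◁ (V ◁ B'.mul ≫ ζ.cell) ⊗≫ bar A B Ψ ▷ V := by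
      rw [whisker_exchange]; bicategory
    _ = 𝟙 _ ⊗≫ V ◁ B'.unit ▷ (A'.t ≫ B'.t) ⊗≫ V ◁ Ψ' ▷ B'.t ⊗≫
          ξ.cell ▷ (B'.t ≫ B'.t) ⊗≫ A.t ◁ ζ.cell ▷ B'.t ⊗≫ A.t ◁ B.t ◁ ζ.cell ⊗≫
          (A.t ◁ B.mul ≫ bar A B Ψ) ▷ V := by
      rw [ζ.mul]; bicategory
    _ = 𝟙 _ ⊗≫ V ◁ B'.unit ▷ (A'.t ≫ B'.t) ⊗≫ V ◁ Ψ' ▷ B'.t ⊗≫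
          ξ.cell ▷ (B'.t ≫ B'.t) ⊗≫ A.t ◁ ζ.cell ▷ B'.t ⊗≫
          ((A.t ≫ B.t) ◁ ζ.cell ≫ bar A B Ψ ▷ (B.t ≫ V)) ⊗≫ A.t ◁ B.mul ▷ V ⊗≫ 𝟙 _ := by
      rw [bar_linear h]; bicategory
    _ = 𝟙 _ ⊗≫ V ◁ B'.unit ▷ (A'.t ≫ B'.t) ⊗≫
          (V ◁ Ψ' ≫ (α_ V A'.t B'.t).inv ≫ ξ.cell ▷ B'.t ≫ (α_ A.t V B'.t).hom ≫ A.t ◁ ζ.cell ≫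
            (α_ A.t B.t V).inv ≫ bar A B Ψ ▷ V) ▷ B'.t ⊗≫
          (A.t ≫ B.t) ◁ ζ.cell ⊗≫ A.t ◁ B.mul ▷ V ⊗≫ 𝟙 _ := by
      rw [whisker_exchange]; bicategory
    _ = 𝟙 _ ⊗≫ ((ρ_ V).inv ≫ V ◁ B'.unit ≫ ζ.cell) ▷ A'.t ▷ B'.t ⊗≫
          B.t ◁ ξ.cell ▷ B'.t ⊗≫ Ψ ▷ (V ≫ B'.t) ⊗≫
          (A.t ≫ B.t) ◁ ζ.cell ⊗≫ A.t ◁ B.mul ▷ V ⊗≫ 𝟙 _ := by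
      rw [← H]; bicategory
    _ = 𝟙 _ ⊗≫ (B.unit ▷ (V ≫ A'.t) ≫ B.t ◁ ξ.cell) ▷ B'.t ⊗≫
          (Ψ ▷ (V ≫ B'.t) ≫ (A.t ≫ B.t) ◁ ζ.cell) ⊗≫ A.t ◁ B.mul ▷ V ⊗≫ 𝟙 _ := by
      rw [ζ.unit]; bicategory
    _ = 𝟙 _ ⊗≫ ξ.cell ▷ B'.t ⊗≫ (B.unit ▷ (A.t ≫ V ≫ B'.t) ≫ B.t ◁ (A.t ◁ ζ.cell)) ⊗≫
          Ψ ▷ (B.t ≫ V) ⊗≫ A.t ◁ B.mul ▷ V ⊗≫ 𝟙 _ := by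
      rw [← whisker_exchange, ← whisker_exchange]; bicategory
    _ = _ := by
      rw [← whisker_exchange, bar_eq h]; bicategory

lemma IsWdlHom.comp {X X' X'' : K} {A B : BMonad X} {A' B' : BMonad X'} {A'' B'' : BMonad X''}
    {Ψ : B.t ≫ A.t ⟶ A.t ≫ B.t} {Ψ' : B'.t ≫ A'.t ⟶ A'.t ≫ B'.t}
    {Ψ'' : B''.t ≫ A''.t ⟶ A''.t ≫ B''.t} {V : X ⟶ X'} {W : X' ⟶ X''}
    {ξ : MonadHom A A' V} {ζ : MonadHom B B' V} {ξ' : MonadHom A' A'' W} {ζ' : MonadHom B' B'' W}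
    (h : IsWeakDistribLaw A B Ψ) (h' : IsWeakDistribLaw A' B' Ψ')
    (H : IsWdlHom Ψ Ψ' ξ ζ) (H' : IsWdlHom Ψ' Ψ'' ξ' ζ') :
    IsWdlHom Ψ Ψ'' (ξ.comp ξ') (ζ.comp ζ') := by
  have HA := H.absorb h h'
  unfold IsWdlHom at *
  dsimp only [MonadHom.comp]
  calc
    _ = 𝟙 _ ⊗≫ V ◁ ζ'.cell ▷ A''.t ⊗≫ (ζ.cell ▷ (W ≫ A''.t) ≫ (B.t ≫ V) ◁ ξ'.cell) ⊗≫
          B.t ◁ ξ.cell ▷ W ⊗≫ Ψ ▷ (V ≫ W) ⊗≫ 𝟙 _ := by bicategory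
    _ = 𝟙 _ ⊗≫ V ◁ ζ'.cell ▷ A''.t ⊗≫ V ◁ B'.t ◁ ξ'.cell ⊗≫
          ((α_ V B'.t A'.t).inv ≫ ζ.cell ▷ A'.t ≫ (α_ B.t V A'.t).hom ≫ B.t ◁ ξ.cell ≫
            (α_ B.t A.t V).inv ≫ Ψ ▷ V) ▷ W ⊗≫ 𝟙 _ := by
      rw [← whisker_exchange]; bicategory
    _ = 𝟙 _ ⊗≫ V ◁ ((α_ W B''.t A''.t).inv ≫ ζ'.cell ▷ A''.t ≫ (α_ B'.t W A''.t).hom ≫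
            B'.t ◁ ξ'.cell ≫ (α_ B'.t A'.t W).inv ≫ Ψ' ▷ W) ⊗≫
          (ξ.cell ▷ B'.t ⊗≫ A.t ◁ ζ.cell ⊗≫ bar A B Ψ ▷ V) ▷ W ⊗≫ 𝟙 _ := by
      rw [H]; bicategory
    _ = 𝟙 _ ⊗≫ V ◁ (W ◁ Ψ'' ⊗≫ ξ'.cell ▷ B''.t ⊗≫ A'.t ◁ ζ'.cell ⊗≫ 𝟙 ((A'.t ≫ B'.t) ≫ W)) ⊗≫
          (V ◁ bar A' B' Ψ' ≫ (α_ V A'.t B'.t).inv ≫ ξ.cell ▷ B'.t ≫ (α_ A.t V B'.t).hom ≫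
            A.t ◁ ζ.cell ≫ (α_ A.t B.t V).inv ≫ bar A B Ψ ▷ V) ▷ W ⊗≫ 𝟙 _ := by
      rw [H']; bicategory
    _ = 𝟙 _ ⊗≫ V ◁ W ◁ Ψ'' ⊗≫ V ◁ ξ'.cell ▷ B''.t ⊗≫
          ((V ≫ A'.t) ◁ ζ'.cell ≫ ξ.cell ▷ (B'.t ≫ W)) ⊗≫
          A.t ◁ ζ.cell ▷ W ⊗≫ bar A B Ψ ▷ (V ≫ W) ⊗≫ 𝟙 _ := by
      rw [HA]; bicategory
    _ = _ := by
      rw [whisker_exchange]; bicategory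

/-- The 0-cells of the bicategory of weak distributive laws in `K`. -/
structure Wdl (K : Type u) [Bicategory.{w, v} K] where
  base : K
  A : BMonad base
  B : BMonad base
  psi : B.t ≫ A.t ⟶ A.t ≫ B.t
  isWeakDistribLaw : IsWeakDistribLaw A B psi

namespace Wdl

/-- The 1-cells: pairs of monad morphisms with a common 1-cell `V`, compatible with the weak
distributive laws. -/
@[ext]
structure Hom (P Q : Wdl K) where
  V : P.base ⟶ Q.base
  xi : MonadHom P.A Q.A V
  zeta : MonadHom P.B Q.B V
  comm : IsWdlHom P.psi Q.psi xi zeta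

/-- The 2-cells: 2-cells of `K` that are monad transformations for both monad morphisms. -/
@[ext]
structure Hom₂ {P Q : Wdl K} (f g : Hom P Q) where
  hom : f.V ⟶ g.V
  xi : IsMonadTrans f.xi g.xi hom
  zeta : IsMonadTrans f.zeta g.zeta hom

@[simps id_V comp_V]
instance : CategoryStruct (Wdl K) where
  Hom P Q := Hom P Q
  id P :=
    { V := 𝟙 P.base
      xi := MonadHom.id P.A
      zeta := MonadHom.id P.B
      comm := IsWdlHom.id P.isWeakDistribLaw }
  comp {P Q _} f g :=
    { V := f.V ≫ g.V
      xi := f.xi.comp g.xi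
      zeta := f.zeta.comp g.zeta
      comm := IsWdlHom.comp P.isWeakDistribLaw Q.isWeakDistribLaw f.comm g.comm }

@[simps id_hom comp_hom]
instance (P Q : Wdl K) : Category (P ⟶ Q) where
  Hom f g := Hom₂ f g
  id f := ⟨𝟙 f.V, .id _, .id _⟩
  comp u v := ⟨u.hom ≫ v.hom, u.xi.comp v.xi, u.zeta.comp v.zeta⟩

@[ext]
lemma hom₂_ext {P Q : Wdl K} {f g : P ⟶ Q} {u v : f ⟶ g} (h : u.hom = v.hom) : u = v :=
  Hom₂.ext h

/-- An invertible 2-cell from an invertible 2-cell of `K`. -/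
@[simps]
def isoMk {P Q : Wdl K} {f g : P ⟶ Q} (e : f.V ≅ g.V) (h₁ : IsMonadTrans f.xi g.xi e.hom)
    (h₂ : IsMonadTrans f.zeta g.zeta e.hom) : f ≅ g where
  hom := ⟨e.hom, h₁, h₂⟩
  inv := ⟨e.inv, h₁.inv, h₂.inv⟩

/-- The bicategory of weak distributive laws; all compositions are induced by those of `K`. -/
@[simps! whiskerLeft_hom whiskerRight_hom associator_hom_hom associator_inv_hom
  leftUnitor_hom_hom leftUnitor_inv_hom rightUnitor_hom_hom rightUnitor_inv_hom]
instance : Bicategory (Wdl K) where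
  homCategory P Q := inferInstance
  whiskerLeft f _ _ u := Hom₂.mk (f.V ◁ u.hom) (.whiskerLeft _ u.xi) (.whiskerLeft _ u.zeta)
  whiskerRight u h := Hom₂.mk (u.hom ▷ h.V) (.whiskerRight _ u.xi) (.whiskerRight _ u.zeta)
  associator f g h := isoMk (α_ f.V g.V h.V) (.associator _ _ _) (.associator _ _ _)
  leftUnitor f := isoMk (λ_ f.V) (.leftUnitor _) (.leftUnitor _)
  rightUnitor f := isoMk (ρ_ f.V) (.rightUnitor _) (.rightUnitor _)
  whisker_exchange u v := by ext; exact whisker_exchange u.hom v.hom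

end Wdl

/-- `f : A ⟶ R` is a morphism of unital monads on the same object (with trivial 1-cell part). -/
structure IsMonadMap {X : K} (A R : BMonad X) (f : A.t ⟶ R.t) : Prop where
  mul : A.mul ≫ f = f ▷ A.t ≫ R.t ◁ f ≫ R.mul
  unit : A.unit ≫ f = R.unit

/-- The 2-cell `π = μ_R (b ⊗ a) : B ⊗ A ⟶ R`. -/
def factProj {X : K} (A B R : BMonad X) (a : A.t ⟶ R.t) (b : B.t ⟶ R.t) :
    A.t ≫ B.t ⟶ R.t :=
  a ▷ B.t ≫ R.t ◁ b ≫ R.mul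

/-- `(a : A ⟶ R ⟵ B : b, i : R ⟶ B ⊗ A)` is a bilinear factorization structure on the monad `R`:
`a` and `b` are monad morphisms and `i` is a section of `π`, as a morphism of `B`-`A` bimodules.
Here `R` is a left `B`-module via `μ_R (b ⊗ R)` and a right `A`-module via `μ_R (R ⊗ a)`. -/
structure IsBilinFact {X : K} (A B R : BMonad X) (a : A.t ⟶ R.t) (b : B.t ⟶ R.t)
    (i : R.t ⟶ A.t ≫ B.t) : Prop where
  alpha : IsMonadMap A R a
  beta : IsMonadMap B R b
  /-- right `A`-linearity: `i μ_R (R ⊗ a) = (B ⊗ μ_A) (i ⊗ A)` -/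
  iota_right : a ▷ R.t ≫ R.mul ≫ i = A.t ◁ i ≫ (α_ A.t A.t B.t).inv ≫ A.mul ▷ B.t
  /-- left `B`-linearity: `i μ_R (b ⊗ R) = (μ_B ⊗ A) (B ⊗ i)` -/
  iota_left : R.t ◁ b ≫ R.mul ≫ i = i ▷ B.t ≫ (α_ A.t B.t B.t).hom ≫ A.t ◁ B.mul
  iota_proj : i ≫ factProj A B R a b = 𝟙 R.t

/-- The 2-cell `Ψ = i μ_R (a ⊗ b) : A ⊗ B ⟶ B ⊗ A`. -/
def factPsi {X : K} (A B R : BMonad X) (a : A.t ⟶ R.t) (b : B.t ⟶ R.t)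
    (i : R.t ⟶ A.t ≫ B.t) : B.t ≫ A.t ⟶ A.t ≫ B.t :=
  b ▷ A.t ≫ R.t ◁ a ≫ R.mul ≫ i

section
variable {X : K} {A B R : BMonad X} {a : A.t ⟶ R.t} {b : B.t ⟶ R.t} {i : R.t ⟶ A.t ≫ B.t}

lemma factPsi_kappa_right (h : IsBilinFact A B R a b i) :
    (λ_ (A.t ≫ B.t)).inv ≫ B.unit ▷ (A.t ≫ B.t) ≫ (α_ B.t A.t B.t).inv ≫
      factPsi A B R a b i ▷ B.t ≫ (α_ A.t B.t B.t).hom ≫ A.t ◁ B.mul =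
    factProj A B R a b ≫ i := by
  unfold factPsi factProj
  calc
    _ = 𝟙 _ ⊗≫ (B.unit ≫ b) ▷ A.t ▷ B.t ⊗≫ R.t ◁ a ▷ B.t ⊗≫ R.mul ▷ B.t ⊗≫
          (i ▷ B.t ≫ (α_ A.t B.t B.t).hom ≫ A.t ◁ B.mul) := by bicategory
    _ = 𝟙 _ ⊗≫ (R.unit ▷ A.t ≫ R.t ◁ a) ▷ B.t ⊗≫ R.mul ▷ B.t ⊗≫
          (R.t ◁ b ≫ R.mul ≫ i) := by
      rw [h.beta.unit, ← h.iota_left]; bicategory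
    _ = 𝟙 _ ⊗≫ a ▷ B.t ⊗≫ (R.unit ▷ R.t ≫ R.mul) ▷ B.t ⊗≫ R.t ◁ b ⊗≫ R.mul ≫ i := by
      rw [← whisker_exchange]; bicategory
    _ = _ := by rw [R.unit_left]; bicategory

lemma factPsi_kappa_left (h : IsBilinFact A B R a b i) :
    (ρ_ (A.t ≫ B.t)).inv ≫ (A.t ≫ B.t) ◁ A.unit ≫ (α_ A.t B.t A.t).hom ≫
      A.t ◁ factPsi A B R a b i ≫ (α_ A.t A.t B.t).inv ≫ A.mul ▷ B.t =
    factProj A B R a b ≫ i := by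
  unfold factPsi factProj
  calc
    _ = 𝟙 _ ⊗≫ A.t ◁ (B.t ◁ A.unit ≫ b ▷ A.t) ⊗≫ A.t ◁ R.t ◁ a ⊗≫ A.t ◁ R.mul ⊗≫
          (A.t ◁ i ≫ (α_ A.t A.t B.t).inv ≫ A.mul ▷ B.t) := by bicategory
    _ = 𝟙 _ ⊗≫ A.t ◁ b ⊗≫ A.t ◁ R.t ◁ (A.unit ≫ a) ⊗≫ A.t ◁ R.mul ⊗≫
          (a ▷ R.t ≫ R.mul ≫ i) := by
      rw [whisker_exchange, h.iota_right]; bicategory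
    _ = 𝟙 _ ⊗≫ A.t ◁ b ⊗≫ A.t ◁ (R.t ◁ R.unit ≫ R.mul) ⊗≫ a ▷ R.t ⊗≫ R.mul ≫ i := by
      rw [h.alpha.unit]; bicategory
    _ = 𝟙 _ ⊗≫ (A.t ◁ b ≫ a ▷ R.t) ⊗≫ R.mul ≫ i := by rw [R.unit_right]; bicategory
    _ = _ := by rw [whisker_exchange]; bicategory

lemma factPsi_isWeakDistribLaw (h : IsBilinFact A B R a b i) :
    IsWeakDistribLaw A B (factPsi A B R a b i) where
  mul_left := by
    have hs := h.iota_proj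
    unfold factProj at hs
    unfold factPsi
    symm
    calc
      _ = 𝟙 _ ⊗≫ b ▷ A.t ▷ A.t ⊗≫ R.t ◁ a ▷ A.t ⊗≫ R.mul ▷ A.t ⊗≫ i ▷ A.t ⊗≫
            A.t ◁ b ▷ A.t ⊗≫ A.t ◁ R.t ◁ a ⊗≫ A.t ◁ R.mul ⊗≫
            (A.t ◁ i ≫ (α_ A.t A.t B.t).inv ≫ A.mul ▷ B.t) := by bicategory
      _ = 𝟙 _ ⊗≫ b ▷ A.t ▷ A.t ⊗≫ R.t ◁ a ▷ A.t ⊗≫ R.mul ▷ A.t ⊗≫ i ▷ A.t ⊗≫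
            (A.t ◁ (b ▷ A.t ≫ R.t ◁ a ≫ R.mul) ≫ a ▷ R.t) ⊗≫ R.mul ≫ i := by
        rw [← h.iota_right]; bicategory
      _ = 𝟙 _ ⊗≫ b ▷ A.t ▷ A.t ⊗≫ R.t ◁ a ▷ A.t ⊗≫ R.mul ▷ A.t ⊗≫ i ▷ A.t ⊗≫
            a ▷ B.t ▷ A.t ⊗≫ R.t ◁ b ▷ A.t ⊗≫ R.t ◁ R.t ◁ a ⊗≫
            ((α_ R.t R.t R.t).hom ≫ R.t ◁ R.mul ≫ R.mul) ⊗≫ i := by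
        rw [whisker_exchange]; bicategory
      _ = 𝟙 _ ⊗≫ b ▷ A.t ▷ A.t ⊗≫ R.t ◁ a ▷ A.t ⊗≫ R.mul ▷ A.t ⊗≫ i ▷ A.t ⊗≫
            a ▷ B.t ▷ A.t ⊗≫ R.t ◁ b ▷ A.t ⊗≫ ((R.t ≫ R.t) ◁ a ≫ R.mul ▷ R.t) ⊗≫
            R.mul ⊗≫ i := by
        rw [← R.assoc]; bicategory
      _ = 𝟙 _ ⊗≫ b ▷ A.t ▷ A.t ⊗≫ R.t ◁ a ▷ A.t ⊗≫ R.mul ▷ A.t ⊗≫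
            (i ≫ a ▷ B.t ≫ R.t ◁ b ≫ R.mul) ▷ A.t ⊗≫ R.t ◁ a ⊗≫ R.mul ⊗≫ i := by
        rw [whisker_exchange]; bicategory
      _ = 𝟙 _ ⊗≫ b ▷ A.t ▷ A.t ⊗≫ R.t ◁ a ▷ A.t ⊗≫ (R.mul ▷ A.t ≫ R.t ◁ a) ⊗≫
            R.mul ⊗≫ i := by
        rw [hs]; bicategory
      _ = 𝟙 _ ⊗≫ b ▷ A.t ▷ A.t ⊗≫ R.t ◁ a ▷ A.t ⊗≫ R.t ◁ R.t ◁ a ⊗≫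
            (R.mul ▷ R.t ≫ R.mul) ⊗≫ i := by
        rw [← whisker_exchange]; bicategory
      _ = 𝟙 _ ⊗≫ b ▷ A.t ▷ A.t ⊗≫ R.t ◁ (a ▷ A.t ≫ R.t ◁ a ≫ R.mul) ⊗≫ R.mul ⊗≫ i := by
        rw [R.assoc]; bicategory
      _ = 𝟙 _ ⊗≫ (b ▷ (A.t ≫ A.t) ≫ R.t ◁ A.mul) ⊗≫ R.t ◁ a ⊗≫ R.mul ⊗≫ i := by
        rw [← h.alpha.mul]; bicategory
      _ = _ := by rw [← whisker_exchange]; bicategory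
  mul_right := by
    have hs := h.iota_proj
    unfold factProj at hs
    unfold factPsi
    symm
    calc
      _ = 𝟙 _ ⊗≫ B.t ◁ b ▷ A.t ⊗≫ B.t ◁ R.t ◁ a ⊗≫ B.t ◁ R.mul ⊗≫ B.t ◁ i ⊗≫
            b ▷ A.t ▷ B.t ⊗≫ R.t ◁ a ▷ B.t ⊗≫ R.mul ▷ B.t ⊗≫
            (i ▷ B.t ≫ (α_ A.t B.t B.t).hom ≫ A.t ◁ B.mul) := by bicategory
      _ = 𝟙 _ ⊗≫ B.t ◁ b ▷ A.t ⊗≫ B.t ◁ R.t ◁ a ⊗≫ B.t ◁ R.mul ⊗≫ B.t ◁ i ⊗≫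
            b ▷ A.t ▷ B.t ⊗≫ R.t ◁ a ▷ B.t ⊗≫ (R.mul ▷ B.t ≫ R.t ◁ b) ⊗≫ R.mul ⊗≫ i := by
        rw [← h.iota_left]; bicategory
      _ = 𝟙 _ ⊗≫ B.t ◁ b ▷ A.t ⊗≫ B.t ◁ R.t ◁ a ⊗≫ B.t ◁ R.mul ⊗≫ B.t ◁ i ⊗≫
            b ▷ A.t ▷ B.t ⊗≫ R.t ◁ a ▷ B.t ⊗≫ R.t ◁ R.t ◁ b ⊗≫
            (R.mul ▷ R.t ≫ R.mul) ⊗≫ i := by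
        rw [← whisker_exchange]; bicategory
      _ = 𝟙 _ ⊗≫ B.t ◁ b ▷ A.t ⊗≫ B.t ◁ R.t ◁ a ⊗≫ B.t ◁ R.mul ⊗≫
            (B.t ◁ i ≫ b ▷ (A.t ≫ B.t)) ⊗≫
            R.t ◁ (a ▷ B.t ≫ R.t ◁ b ≫ R.mul) ⊗≫ R.mul ⊗≫ i := by
        rw [R.assoc]; bicategory
      _ = 𝟙 _ ⊗≫ B.t ◁ b ▷ A.t ⊗≫ B.t ◁ R.t ◁ a ⊗≫ (B.t ◁ R.mul ≫ b ▷ R.t) ⊗≫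
            R.t ◁ (i ≫ a ▷ B.t ≫ R.t ◁ b ≫ R.mul) ⊗≫ R.mul ⊗≫ i := by
        rw [whisker_exchange]; bicategory
      _ = 𝟙 _ ⊗≫ B.t ◁ b ▷ A.t ⊗≫ (B.t ◁ (R.t ◁ a) ≫ b ▷ (R.t ≫ R.t)) ⊗≫ R.t ◁ R.mul ⊗≫
            R.mul ⊗≫ i := by
        rw [hs, whisker_exchange]; bicategory
      _ = 𝟙 _ ⊗≫ (B.t ◁ b ≫ b ▷ R.t) ▷ A.t ⊗≫ R.t ◁ R.t ◁ a ⊗≫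
            ((α_ R.t R.t R.t).hom ≫ R.t ◁ R.mul ≫ R.mul) ⊗≫ i := by
        rw [whisker_exchange]; bicategory
      _ = 𝟙 _ ⊗≫ (b ▷ B.t ≫ R.t ◁ b) ▷ A.t ⊗≫ ((R.t ≫ R.t) ◁ a ≫ R.mul ▷ R.t) ⊗≫ R.mul ⊗≫ i := by
        rw [← R.assoc, whisker_exchange]; bicategory
      _ = 𝟙 _ ⊗≫ (b ▷ B.t ≫ R.t ◁ b ≫ R.mul) ▷ A.t ⊗≫ R.t ◁ a ⊗≫ R.mul ⊗≫ i := by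
        rw [whisker_exchange]; bicategory
      _ = _ := by rw [← h.beta.mul]; bicategory
  unit := by rw [factPsi_kappa_right h, factPsi_kappa_left h]

lemma bar_factPsi (h : IsBilinFact A B R a b i) :
    bar A B (factPsi A B R a b i) = factProj A B R a b ≫ i := by
  rw [bar_eq (factPsi_isWeakDistribLaw h), factPsi_kappa_right h]
end

/-- The 0-cells of the bicategory of bilinear factorization structures in `K`. -/
structure Bf (K : Type u) [Bicategory.{w, v} K] where
  base : K
  A : BMonad base
  B : BMonad base
  R : BMonad base
  alpha : A.t ⟶ R.t
  beta : B.t ⟶ R.t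
  iota : R.t ⟶ A.t ≫ B.t
  isBilinFact : IsBilinFact A B R alpha beta iota

namespace Bf

/-- The 1-cells: triples of monad morphisms with a common 1-cell `V` such that
`rho (alpha' ⊗ V) = (V ⊗ alpha) xi` and `rho (beta' ⊗ V) = (V ⊗ beta) zeta`. -/
@[ext]
structure Hom (P Q : Bf K) where
  V : P.base ⟶ Q.base
  xi : MonadHom P.A Q.A V
  zeta : MonadHom P.B Q.B V
  rho : MonadHom P.R Q.R V
  comm_alpha : V ◁ Q.alpha ≫ rho.cell = xi.cell ≫ P.alpha ▷ V
  comm_beta : V ◁ Q.beta ≫ rho.cell = zeta.cell ≫ P.beta ▷ V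

/-- The 2-cells: 2-cells of `K` that are monad transformations for all three monad morphisms. -/
@[ext]
structure Hom₂ {P Q : Bf K} (f g : Hom P Q) where
  hom : f.V ⟶ g.V
  xi : IsMonadTrans f.xi g.xi hom
  zeta : IsMonadTrans f.zeta g.zeta hom
  rho : IsMonadTrans f.rho g.rho hom

lemma comm_id {X : K} {A R : BMonad X} (a : A.t ⟶ R.t) :
    𝟙 X ◁ a ≫ (MonadHom.id R).cell = (MonadHom.id A).cell ≫ a ▷ 𝟙 X := by
  simp [MonadHom.id]

lemma comm_comp {X X' X'' : K} {A R : BMonad X} {A' R' : BMonad X'} {A'' R'' : BMonad X''}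
    {a : A.t ⟶ R.t} {a' : A'.t ⟶ R'.t} {a'' : A''.t ⟶ R''.t} {V : X ⟶ X'} {W : X' ⟶ X''}
    {x : MonadHom A A' V} {r : MonadHom R R' V} {y : MonadHom A' A'' W} {s : MonadHom R' R'' W}
    (h : V ◁ a' ≫ r.cell = x.cell ≫ a ▷ V) (k : W ◁ a'' ≫ s.cell = y.cell ≫ a' ▷ W) :
    (V ≫ W) ◁ a'' ≫ (r.comp s).cell = (x.comp y).cell ≫ a ▷ (V ≫ W) := by
  dsimp only [MonadHom.comp]
  calc
    _ = 𝟙 _ ⊗≫ V ◁ (W ◁ a'' ≫ s.cell) ⊗≫ r.cell ▷ W ⊗≫ 𝟙 _ := by bicategory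
    _ = 𝟙 _ ⊗≫ V ◁ y.cell ⊗≫ (V ◁ a' ≫ r.cell) ▷ W ⊗≫ 𝟙 _ := by rw [k]; bicategory
    _ = _ := by rw [h]; bicategory

@[simps id_V comp_V]
instance : CategoryStruct (Bf K) where
  Hom P Q := Hom P Q
  id P :=
    { V := 𝟙 P.base
      xi := MonadHom.id P.A
      zeta := MonadHom.id P.B
      rho := MonadHom.id P.R
      comm_alpha := comm_id _
      comm_beta := comm_id _ }
  comp f g :=
    { V := f.V ≫ g.V
      xi := f.xi.comp g.xi
      zeta := f.zeta.comp g.zeta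
      rho := f.rho.comp g.rho
      comm_alpha := comm_comp f.comm_alpha g.comm_alpha
      comm_beta := comm_comp f.comm_beta g.comm_beta }

@[simps id_hom comp_hom]
instance (P Q : Bf K) : Category (P ⟶ Q) where
  Hom f g := Hom₂ f g
  id f := ⟨𝟙 f.V, .id _, .id _, .id _⟩
  comp u v := ⟨u.hom ≫ v.hom, u.xi.comp v.xi, u.zeta.comp v.zeta, u.rho.comp v.rho⟩

@[ext]
lemma hom₂_ext {P Q : Bf K} {f g : P ⟶ Q} {u v : f ⟶ g} (h : u.hom = v.hom) : u = v :=
  Hom₂.ext h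

/-- An invertible 2-cell from an invertible 2-cell of `K`. -/
@[simps]
def isoMk {P Q : Bf K} {f g : P ⟶ Q} (e : f.V ≅ g.V) (h₁ : IsMonadTrans f.xi g.xi e.hom)
    (h₂ : IsMonadTrans f.zeta g.zeta e.hom) (h₃ : IsMonadTrans f.rho g.rho e.hom) : f ≅ g where
  hom := ⟨e.hom, h₁, h₂, h₃⟩
  inv := ⟨e.inv, h₁.inv, h₂.inv, h₃.inv⟩

/-- The bicategory of bilinear factorization structures; all compositions are induced by those
of `K`. -/
@[simps! whiskerLeft_hom whiskerRight_hom associator_hom_hom associator_inv_hom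
  leftUnitor_hom_hom leftUnitor_inv_hom rightUnitor_hom_hom rightUnitor_inv_hom]
instance : Bicategory (Bf K) where
  homCategory P Q := inferInstance
  whiskerLeft f _ _ u :=
    Hom₂.mk (f.V ◁ u.hom) (.whiskerLeft _ u.xi) (.whiskerLeft _ u.zeta) (.whiskerLeft _ u.rho)
  whiskerRight u h :=
    Hom₂.mk (u.hom ▷ h.V) (.whiskerRight _ u.xi) (.whiskerRight _ u.zeta) (.whiskerRight _ u.rho)
  associator f g h :=
    isoMk (α_ f.V g.V h.V) (.associator _ _ _) (.associator _ _ _) (.associator _ _ _)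
  leftUnitor f := isoMk (λ_ f.V) (.leftUnitor _) (.leftUnitor _) (.leftUnitor _)
  rightUnitor f := isoMk (ρ_ f.V) (.rightUnitor _) (.rightUnitor _) (.rightUnitor _)
  whisker_exchange u v := by ext; exact whisker_exchange u.hom v.hom

lemma Hom.factProj_comm {P Q : Bf K} (f : Hom P Q) :
    f.V ◁ factProj Q.A Q.B Q.R Q.alpha Q.beta ≫ f.rho.cell =
      (α_ f.V Q.A.t Q.B.t).inv ≫ f.xi.cell ▷ Q.B.t ≫ (α_ P.A.t f.V Q.B.t).hom ≫
        P.A.t ◁ f.zeta.cell ≫ (α_ P.A.t P.B.t f.V).inv ≫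
        factProj P.A P.B P.R P.alpha P.beta ▷ f.V := by
  unfold factProj
  calc
    _ = 𝟙 _ ⊗≫ f.V ◁ Q.alpha ▷ Q.B.t ⊗≫ f.V ◁ Q.R.t ◁ Q.beta ⊗≫
          (f.V ◁ Q.R.mul ≫ f.rho.cell) := by bicategory
    _ = 𝟙 _ ⊗≫ f.V ◁ Q.alpha ▷ Q.B.t ⊗≫ ((f.V ≫ Q.R.t) ◁ Q.beta ≫ f.rho.cell ▷ Q.R.t) ⊗≫
          P.R.t ◁ f.rho.cell ⊗≫ P.R.mul ▷ f.V := by rw [f.rho.mul]; bicategory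
    _ = 𝟙 _ ⊗≫ (f.V ◁ Q.alpha ≫ f.rho.cell) ▷ Q.B.t ⊗≫ P.R.t ◁ (f.V ◁ Q.beta ≫ f.rho.cell) ⊗≫
          P.R.mul ▷ f.V := by rw [whisker_exchange]; bicategory
    _ = 𝟙 _ ⊗≫ f.xi.cell ▷ Q.B.t ⊗≫ (P.alpha ▷ (f.V ≫ Q.B.t) ≫ P.R.t ◁ f.zeta.cell) ⊗≫
          P.R.t ◁ P.beta ▷ f.V ⊗≫ P.R.mul ▷ f.V := by
      rw [f.comm_alpha, f.comm_beta]; bicategory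
    _ = _ := by rw [← whisker_exchange]; bicategory

lemma Hom.isWdlHom {P Q : Bf K} (f : Hom P Q) :
    IsWdlHom (factPsi P.A P.B P.R P.alpha P.beta P.iota)
      (factPsi Q.A Q.B Q.R Q.alpha Q.beta Q.iota) f.xi f.zeta := by
  have hp := f.factProj_comm
  unfold IsWdlHom
  rw [bar_factPsi P.isBilinFact]
  symm
  calc
    _ = 𝟙 _ ⊗≫ f.V ◁ factPsi Q.A Q.B Q.R Q.alpha Q.beta Q.iota ⊗≫
          ((α_ f.V Q.A.t Q.B.t).inv ≫ f.xi.cell ▷ Q.B.t ≫ (α_ P.A.t f.V Q.B.t).hom ≫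
            P.A.t ◁ f.zeta.cell ≫ (α_ P.A.t P.B.t f.V).inv ≫
            factProj P.A P.B P.R P.alpha P.beta ▷ f.V) ⊗≫ P.iota ▷ f.V := by bicategory
    _ = 𝟙 _ ⊗≫ f.V ◁ (Q.beta ▷ Q.A.t ≫ Q.R.t ◁ Q.alpha ≫ Q.R.mul) ⊗≫
          f.V ◁ (Q.iota ≫ factProj Q.A Q.B Q.R Q.alpha Q.beta) ⊗≫
          f.rho.cell ⊗≫ P.iota ▷ f.V := by
      rw [← hp, factPsi]; bicategory
    _ = 𝟙 _ ⊗≫ f.V ◁ Q.beta ▷ Q.A.t ⊗≫ f.V ◁ Q.R.t ◁ Q.alpha ⊗≫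
          (f.V ◁ Q.R.mul ≫ f.rho.cell) ⊗≫ P.iota ▷ f.V := by
      rw [Q.isBilinFact.iota_proj]; bicategory
    _ = 𝟙 _ ⊗≫ f.V ◁ Q.beta ▷ Q.A.t ⊗≫ ((f.V ≫ Q.R.t) ◁ Q.alpha ≫ f.rho.cell ▷ Q.R.t) ⊗≫
          P.R.t ◁ f.rho.cell ⊗≫ P.R.mul ▷ f.V ⊗≫ P.iota ▷ f.V := by
      rw [f.rho.mul]; bicategory
    _ = 𝟙 _ ⊗≫ (f.V ◁ Q.beta ≫ f.rho.cell) ▷ Q.A.t ⊗≫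
          P.R.t ◁ (f.V ◁ Q.alpha ≫ f.rho.cell) ⊗≫ P.R.mul ▷ f.V ⊗≫ P.iota ▷ f.V := by
      rw [whisker_exchange]; bicategory
    _ = 𝟙 _ ⊗≫ f.zeta.cell ▷ Q.A.t ⊗≫ (P.beta ▷ (f.V ≫ Q.A.t) ≫ P.R.t ◁ f.xi.cell) ⊗≫
          P.R.t ◁ P.alpha ▷ f.V ⊗≫ P.R.mul ▷ f.V ⊗≫ P.iota ▷ f.V := by
      rw [f.comm_alpha, f.comm_beta]; bicategory
    _ = _ := by rw [← whisker_exchange, factPsi]; bicategory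

end Bf

/-- The pseudofunctor sending a bilinear factorization structure to the weak distributive law
`Ψ = ι μ_R (α ⊗ β)`, a 1-cell `(ξ, ζ, ρ)` to `(ξ, ζ)`, and acting as the identity on 2-cells. -/
def toWdl (K : Type u) [Bicategory.{w, v} K] : Pseudofunctor (Bf K) (Wdl K) where
  obj P :=
    { base := P.base
      A := P.A
      B := P.B
      psi := factPsi P.A P.B P.R P.alpha P.beta P.iota
      isWeakDistribLaw := factPsi_isWeakDistribLaw P.isBilinFact }
  map f :=
    { V := f.V
      xi := f.xi
      zeta := f.zeta
      comm := f.isWdlHom }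
  map₂ u := Wdl.Hom₂.mk u.hom u.xi u.zeta
  mapId P := Wdl.isoMk (Iso.refl (𝟙 P.base)) (.id _) (.id _)
  mapComp f g := Wdl.isoMk (Iso.refl (f.V ≫ g.V)) (.id _) (.id _)

/-- A pseudofunctor is a biequivalence if every 0-cell of the target is equivalent (in the target
bicategory) to one in its image, and it induces equivalences of hom categories. -/
structure IsBiequivalence {C : Type*} [Bicategory C] {D : Type*} [Bicategory D]
    (G : Pseudofunctor C D) : Prop where
  biessSurj : ∀ Y : D, ∃ X : C, Nonempty (Bicategory.Equivalence (G.obj X) Y)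
  homEquiv : ∀ X X' : C, (G.mapFunctor X X').IsEquivalence

end BilinFac

/-!
The pseudofunctor is strictly surjective on 0-cells and an isomorphism on sets of 2-cells, so the work
is in two constructions.

*From weak distributive laws to factorizations.* For a weak distributive law `Ψ` the multiplication
`wreathMul` on `B ⊗ A` is associative, and `η_B ⊗ η_A` is a preunit for it: multiplication by it on
either side is the idempotent `bar A B Ψ`, which fixes `wreathMul` (`wreathPreMonad`). Splitting the
idempotent as `π : B ⊗ A ⟶ R`, `ι : R ⟶ B ⊗ A` therefore yields a monad `R` (`PreMonad.split`). Since
`bar` is a bimodule map, `π (η_B ⊗ A)`, `π (B ⊗ η_A)` and `ι` form a bilinear factorization structure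
(`isBilinFact_of_isSplitting`), and its weak distributive law is `Ψ` itself
(`factPsi_of_isSplitting`).

*From compatible pairs to triples.* Since `π'` is a split epimorphism, a 2-cell `ρ : R' ⊗ V ⟶ V ⊗ R`
compatible with `ξ` and `ζ` is determined by `ρ π' = (V ⊗ π) (ζ ⊗ A) (B' ⊗ ξ)`; this gives fullness on
2-cells (`isMonadTrans_of_factProj`). Conversely, for a 1-cell `(ξ, ζ)` of weak distributive laws,
`ρ := (V ⊗ π) (ζ ⊗ A) (B' ⊗ ξ) (ι' ⊗ V)` satisfies this equation (`factProj_iota_pairCell`). It is then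
linear over `A` and `B`, and the compatibility of `(ξ, ζ)` with `Ψ` and `Ψ'` is multiplicativity of `ρ`
on the products `α' β'` (`crossing_iota_pairCell`); together these make `ρ` a monad morphism
(`extension_mul`).
-/

namespace BilinFac

variable {K : Type u} [Bicategory.{w, v} K]

/-! ### Monads with a preunit -/

/-- An endo-1-cell with an associative multiplication and a preunit: multiplying by `unit` on either
side gives one and the same 2-cell `idem`, which fixes the multiplication. It is a monad when `idem`
is the identity, and in general becomes one once `idem` is split. -/
structure PreMonad (X : K) where
  t : X ⟶ X
  mul : t ≫ t ⟶ t
  unit : 𝟙 X ⟶ t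
  idem : t ⟶ t
  assoc : mul ▷ t ≫ mul = (α_ t t t).hom ≫ t ◁ mul ≫ mul
  unit_left : unit ▷ t ≫ mul = (λ_ t).hom ≫ idem
  unit_right : t ◁ unit ≫ mul = (ρ_ t).hom ≫ idem
  mul_idem : mul ≫ idem = mul

namespace PreMonad
variable {X : K} (T : PreMonad X)

/-- By associativity, since `idem` is multiplication by the preunit and fixes `mul`. -/
lemma idem_whiskerRight_mul : T.idem ▷ T.t ≫ T.mul = T.mul := by
  calc
    _ = 𝟙 _ ⊗≫ ((λ_ T.t).hom ≫ T.idem) ▷ T.t ⊗≫ T.mul := by bicategory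
    _ = 𝟙 _ ⊗≫ T.unit ▷ T.t ▷ T.t ⊗≫ (T.mul ▷ T.t ≫ T.mul) := by
      rw [← T.unit_left]; bicategory
    _ = 𝟙 _ ⊗≫ (T.unit ▷ (T.t ≫ T.t) ≫ T.t ◁ T.mul) ⊗≫ T.mul := by
      rw [T.assoc]; bicategory
    _ = 𝟙 _ ⊗≫ T.mul ⊗≫ (T.unit ▷ T.t ≫ T.mul) := by
      rw [← whisker_exchange]; bicategory
    _ = T.mul ≫ T.idem := by rw [T.unit_left]; bicategory
    _ = _ := T.mul_idem

lemma idem_whiskerLeft_mul : T.t ◁ T.idem ≫ T.mul = T.mul := by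
  calc
    _ = 𝟙 _ ⊗≫ T.t ◁ ((ρ_ T.t).hom ≫ T.idem) ⊗≫ T.mul := by bicategory
    _ = 𝟙 _ ⊗≫ T.t ◁ T.t ◁ T.unit ⊗≫ ((α_ T.t T.t T.t).hom ≫ T.t ◁ T.mul ≫ T.mul) := by
      rw [← T.unit_right]; bicategory
    _ = 𝟙 _ ⊗≫ ((T.t ≫ T.t) ◁ T.unit ≫ T.mul ▷ T.t) ⊗≫ T.mul := by
      rw [← T.assoc]; bicategory
    _ = 𝟙 _ ⊗≫ T.mul ⊗≫ (T.t ◁ T.unit ≫ T.mul) := by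
      rw [whisker_exchange]; bicategory
    _ = T.mul ≫ T.idem := by rw [T.unit_right]; bicategory
    _ = _ := T.mul_idem

lemma idem_idem : T.idem ≫ T.idem = T.idem := by
  have h : T.idem = (λ_ T.t).inv ≫ T.unit ▷ T.t ≫ T.mul := by simp [T.unit_left]
  calc
    T.idem ≫ T.idem = (λ_ T.t).inv ≫ T.unit ▷ T.t ≫ T.mul ≫ T.idem := by
      simp only [reassoc_of% h]
    _ = _ := by rw [T.mul_idem, ← h]

variable {r : X ⟶ X} {i : r ⟶ T.t} {p : T.t ⟶ r}

/-- The monad on a splitting `t ⟶ r ⟶ t` of the idempotent of a `PreMonad`. -/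
def split (hr : i ≫ p = 𝟙 r) (he : p ≫ i = T.idem) : BMonad X where
  t := r
  mul := i ▷ r ≫ T.t ◁ i ≫ T.mul ≫ p
  unit := T.unit ≫ p
  assoc := by
    calc
      _ = 𝟙 _ ⊗≫ i ▷ r ▷ r ⊗≫ T.t ◁ i ▷ r ⊗≫ T.mul ▷ r ⊗≫ ((p ≫ i) ▷ r ≫ T.t ◁ i) ⊗≫
            T.mul ≫ p := by bicategory
      _ = 𝟙 _ ⊗≫ i ▷ r ▷ r ⊗≫ T.t ◁ i ▷ r ⊗≫ (T.mul ▷ r ≫ T.t ◁ i) ⊗≫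
            (T.idem ▷ T.t ≫ T.mul) ≫ p := by rw [he, ← whisker_exchange]; bicategory
      _ = 𝟙 _ ⊗≫ i ▷ r ▷ r ⊗≫ T.t ◁ (i ▷ r ≫ T.t ◁ i) ⊗≫ (T.mul ▷ T.t ≫ T.mul) ≫ p := by
        rw [T.idem_whiskerRight_mul, ← whisker_exchange]; bicategory
      _ = 𝟙 _ ⊗≫ i ▷ r ▷ r ⊗≫ T.t ◁ (i ▷ r ≫ T.t ◁ i) ⊗≫ T.t ◁ T.mul ≫
            (T.t ◁ T.idem ≫ T.mul) ≫ p := by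
        rw [T.assoc, T.idem_whiskerLeft_mul]; bicategory
      _ = 𝟙 _ ⊗≫ (i ▷ (r ≫ r) ≫ T.t ◁ (i ▷ r ≫ T.t ◁ i ≫ T.mul ≫ p)) ⊗≫ T.t ◁ i ⊗≫
            T.mul ≫ p := by rw [← he]; bicategory
      _ = _ := by rw [← whisker_exchange]; bicategory
  unit_left := by
    calc
      _ = 𝟙 _ ⊗≫ (T.unit ▷ r ≫ (p ≫ i) ▷ r ≫ T.t ◁ i) ⊗≫ T.mul ≫ p := by bicategory
      _ = 𝟙 _ ⊗≫ (T.unit ▷ r ≫ T.t ◁ i) ⊗≫ (T.idem ▷ T.t ≫ T.mul) ≫ p := by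
        rw [he, ← whisker_exchange]; bicategory
      _ = 𝟙 _ ⊗≫ i ⊗≫ (T.unit ▷ T.t ≫ T.mul) ≫ p := by
        rw [T.idem_whiskerRight_mul, ← whisker_exchange]; bicategory
      _ = (λ_ r).hom ≫ (i ≫ p) ≫ (i ≫ p) := by
        rw [T.unit_left, ← he]; bicategory
      _ = _ := by simp [hr]
  unit_right := by
    calc
      _ = 𝟙 _ ⊗≫ (r ◁ (T.unit ≫ p) ≫ i ▷ r) ⊗≫ T.t ◁ i ⊗≫ T.mul ≫ p := by bicategory
      _ = 𝟙 _ ⊗≫ i ⊗≫ T.t ◁ T.unit ⊗≫ T.t ◁ (p ≫ i) ⊗≫ T.mul ≫ p := by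
        rw [whisker_exchange]; bicategory
      _ = 𝟙 _ ⊗≫ i ⊗≫ T.t ◁ T.unit ⊗≫ (T.t ◁ T.idem ≫ T.mul) ≫ p := by
        rw [he]; bicategory
      _ = 𝟙 _ ⊗≫ i ⊗≫ (T.t ◁ T.unit ≫ T.mul) ≫ p := by
        rw [T.idem_whiskerLeft_mul]; bicategory
      _ = (ρ_ r).hom ≫ (i ≫ p) ≫ (i ≫ p) := by
        rw [T.unit_right, ← he]; bicategory
      _ = _ := by simp [hr]

/-- The monad `R` arises from the `PreMonad` `T` by splitting its idempotent as `T ⟶ R ⟶ T`. It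
suffices to describe the multiplication of `R` after the monomorphism `i`. -/
structure IsSplitting (R : BMonad X) (i : R.t ⟶ T.t) (p : T.t ⟶ R.t) : Prop where
  incl_proj : i ≫ p = 𝟙 R.t
  proj_incl : p ≫ i = T.idem
  mul_incl : R.mul ≫ i = i ▷ R.t ≫ T.t ◁ i ≫ T.mul
  unit_eq : R.unit = T.unit ≫ p

lemma isSplitting_split (hr : i ≫ p = 𝟙 r) (he : p ≫ i = T.idem) :
    T.IsSplitting (T.split hr he) i p where
  incl_proj := hr
  proj_incl := he
  mul_incl := by
    change (i ▷ r ≫ T.t ◁ i ≫ T.mul ≫ p) ≫ i = i ▷ r ≫ T.t ◁ i ≫ T.mul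
    simp only [Category.assoc, he, T.mul_idem]
  unit_eq := rfl

namespace IsSplitting
variable {T} {R : BMonad X} {i : R.t ⟶ T.t} {p : T.t ⟶ R.t} (S : T.IsSplitting R i p)
include S

lemma proj_mul_incl : p ▷ T.t ≫ R.t ◁ p ≫ R.mul ≫ i = T.mul := by
  rw [S.mul_incl]
  calc
    _ = 𝟙 _ ⊗≫ p ▷ T.t ⊗≫ (R.t ◁ p ≫ i ▷ R.t) ⊗≫ T.t ◁ i ⊗≫ T.mul := by bicategory
    _ = 𝟙 _ ⊗≫ (p ≫ i) ▷ T.t ⊗≫ T.t ◁ (p ≫ i) ⊗≫ T.mul := by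
      rw [whisker_exchange]; bicategory
    _ = 𝟙 _ ⊗≫ T.idem ▷ T.t ⊗≫ (T.t ◁ T.idem ≫ T.mul) := by rw [S.proj_incl]; bicategory
    _ = 𝟙 _ ⊗≫ (T.idem ▷ T.t ≫ T.mul) := by rw [T.idem_whiskerLeft_mul]; bicategory
    _ = _ := by rw [T.idem_whiskerRight_mul]; bicategory

lemma proj_mul : p ▷ T.t ≫ R.t ◁ p ≫ R.mul = T.mul ≫ p := by
  have h : R.mul = (R.mul ≫ i) ≫ p := by rw [Category.assoc, S.incl_proj, Category.comp_id]
  rw [← S.proj_mul_incl, h]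
  simp only [Category.assoc, S.incl_proj, Category.comp_id]

lemma idem_proj : T.idem ≫ p = p := by
  rw [← S.proj_incl, Category.assoc, S.incl_proj, Category.comp_id]

lemma incl_idem : i ≫ T.idem = i := by
  rw [← S.proj_incl, reassoc_of% S.incl_proj]

lemma incl_mono : Mono i := (SplitMono.mk p S.incl_proj).mono

end IsSplitting
end PreMonad

/-! ### The weak wreath product -/

section
variable {X : K} {A B : BMonad X} {Ψ : B.t ≫ A.t ⟶ A.t ≫ B.t}

/-- The other expression of `bar`, with the unit of `A` in place of the unit of `B`. -/
lemma bar_eq_left (h : IsWeakDistribLaw A B Ψ) : bar A B Ψ =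
    (ρ_ (A.t ≫ B.t)).inv ≫ (A.t ≫ B.t) ◁ A.unit ≫ (α_ A.t B.t A.t).hom ≫ A.t ◁ Ψ ≫
      (α_ A.t A.t B.t).inv ≫ A.mul ▷ B.t := by
  rw [bar_eq h, h.unit]

/-- With `bar_linear`: `bar` is a morphism of `B`-`A` bimodules. -/
lemma bar_linear_left (h : IsWeakDistribLaw A B Ψ) :
    A.mul ▷ B.t ≫ bar A B Ψ =
      (α_ A.t A.t B.t).hom ≫ A.t ◁ bar A B Ψ ≫ (α_ A.t A.t B.t).inv ≫ A.mul ▷ B.t := by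
  rw [bar_eq_left h]
  calc
    _ = 𝟙 _ ⊗≫ (A.mul ▷ (B.t ≫ 𝟙 X) ≫ A.t ◁ (B.t ◁ A.unit)) ⊗≫ A.t ◁ Ψ ⊗≫ A.mul ▷ B.t := by
      bicategory
    _ = 𝟙 _ ⊗≫ A.t ◁ A.t ◁ B.t ◁ A.unit ⊗≫ (A.mul ▷ (B.t ≫ A.t) ≫ A.t ◁ Ψ) ⊗≫
          A.mul ▷ B.t := by
      rw [← whisker_exchange]; bicategory
    _ = 𝟙 _ ⊗≫ A.t ◁ A.t ◁ B.t ◁ A.unit ⊗≫ A.t ◁ A.t ◁ Ψ ⊗≫ (A.mul ▷ A.t ≫ A.mul) ▷ B.t := by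
      rw [← whisker_exchange]; bicategory
    _ = _ := by rw [A.assoc]; bicategory

lemma wreathMul_assoc (h : IsWeakDistribLaw A B Ψ) :
    wreathMul A B Ψ ▷ (A.t ≫ B.t) ≫ wreathMul A B Ψ =
      (α_ (A.t ≫ B.t) (A.t ≫ B.t) (A.t ≫ B.t)).hom ≫ (A.t ≫ B.t) ◁ wreathMul A B Ψ ≫
        wreathMul A B Ψ := by
  unfold wreathMul
  calc
    _ = 𝟙 _ ⊗≫ A.t ◁ Ψ ▷ B.t ▷ A.t ▷ B.t ⊗≫
          (A.mul ▷ (B.t ≫ B.t ≫ A.t ≫ B.t) ≫ A.t ◁ ((α_ _ _ _).inv ≫ (α_ _ _ _).inv ≫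
            (B.mul ▷ A.t ≫ Ψ) ▷ B.t)) ⊗≫
          A.mul ▷ B.t ▷ B.t ⊗≫ A.t ◁ B.mul := by bicategory
    _ = 𝟙 _ ⊗≫ A.t ◁ Ψ ▷ B.t ▷ A.t ▷ B.t ⊗≫ A.t ◁ A.t ◁ B.t ◁ Ψ ▷ B.t ⊗≫
          A.t ◁ A.t ◁ Ψ ▷ B.t ▷ B.t ⊗≫ A.t ◁ A.t ◁ A.t ◁ B.mul ▷ B.t ⊗≫
          (A.mul ▷ A.t ≫ A.mul) ▷ B.t ▷ B.t ⊗≫ A.t ◁ B.mul := by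
      rw [← whisker_exchange, h.mul_right]; bicategory
    _ = 𝟙 _ ⊗≫ A.t ◁ (Ψ ▷ (B.t ≫ A.t) ≫ (A.t ≫ B.t) ◁ Ψ) ▷ B.t ⊗≫
          A.t ◁ A.t ◁ Ψ ▷ B.t ▷ B.t ⊗≫ A.t ◁ ((A.t ≫ A.t) ◁ B.mul ≫ A.mul ▷ B.t) ▷ B.t ⊗≫
          A.mul ▷ B.t ▷ B.t ⊗≫ A.t ◁ B.mul := by
      rw [A.assoc]; bicategory
    _ = 𝟙 _ ⊗≫ A.t ◁ B.t ◁ A.t ◁ Ψ ▷ B.t ⊗≫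
          A.t ◁ (Ψ ▷ A.t ≫ (α_ A.t B.t A.t).hom ≫ A.t ◁ Ψ ≫
            (α_ A.t A.t B.t).inv ≫ A.mul ▷ B.t) ▷ B.t ▷ B.t ⊗≫
          (A.t ≫ A.t) ◁ (B.mul ▷ B.t) ⊗≫ A.mul ▷ B.t ▷ B.t ⊗≫ A.t ◁ B.mul := by
      rw [← whisker_exchange Ψ Ψ, whisker_exchange A.mul B.mul]; bicategory
    _ = 𝟙 _ ⊗≫ A.t ◁ B.t ◁ A.t ◁ Ψ ▷ B.t ⊗≫
          A.t ◁ ((α_ B.t A.t A.t).hom ≫ B.t ◁ A.mul ≫ Ψ) ▷ B.t ▷ B.t ⊗≫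
          ((A.t ≫ A.t) ◁ (B.mul ▷ B.t) ≫ A.mul ▷ (B.t ≫ B.t)) ⊗≫ A.t ◁ B.mul := by
      rw [h.mul_left]; bicategory
    _ = 𝟙 _ ⊗≫ A.t ◁ B.t ◁ A.t ◁ Ψ ▷ B.t ⊗≫
          A.t ◁ ((α_ B.t A.t A.t).hom ≫ B.t ◁ A.mul ≫ Ψ) ▷ B.t ▷ B.t ⊗≫
          A.mul ▷ (B.t ≫ B.t ≫ B.t) ⊗≫ A.t ◁ (B.mul ▷ B.t ≫ B.mul) := by
      rw [whisker_exchange]; bicategory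
    _ = 𝟙 _ ⊗≫ A.t ◁ B.t ◁ A.t ◁ Ψ ▷ B.t ⊗≫
          A.t ◁ B.t ◁ A.mul ▷ B.t ▷ B.t ⊗≫ A.t ◁ Ψ ▷ B.t ▷ B.t ⊗≫
          (A.mul ▷ (B.t ≫ B.t ≫ B.t) ≫ A.t ◁ (B.t ◁ B.mul)) ⊗≫ A.t ◁ B.mul := by
      rw [B.assoc]; bicategory
    _ = 𝟙 _ ⊗≫ A.t ◁ B.t ◁ A.t ◁ Ψ ▷ B.t ⊗≫
          A.t ◁ B.t ◁ A.mul ▷ B.t ▷ B.t ⊗≫ A.t ◁ (Ψ ▷ (B.t ≫ B.t) ≫ (A.t ≫ B.t) ◁ B.mul) ⊗≫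
          A.mul ▷ (B.t ≫ B.t) ⊗≫ A.t ◁ B.mul := by
      rw [← whisker_exchange]; bicategory
    _ = _ := by
      rw [← whisker_exchange]; bicategory

lemma wreathMul_comp_bar (h : IsWeakDistribLaw A B Ψ) :
    wreathMul A B Ψ ≫ bar A B Ψ = wreathMul A B Ψ := by
  unfold wreathMul
  calc
    _ = 𝟙 _ ⊗≫ A.t ◁ Ψ ▷ B.t ⊗≫ A.mul ▷ (B.t ≫ B.t) ⊗≫ (A.t ◁ B.mul ≫ bar A B Ψ) := by
      bicategory
    _ = 𝟙 _ ⊗≫ A.t ◁ Ψ ▷ B.t ⊗≫ (A.mul ▷ B.t ≫ bar A B Ψ) ▷ B.t ⊗≫ A.t ◁ B.mul := by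
      rw [bar_linear h]; bicategory
    _ = 𝟙 _ ⊗≫ A.t ◁ (Ψ ≫ bar A B Ψ) ▷ B.t ⊗≫ A.mul ▷ (B.t ≫ B.t) ⊗≫ A.t ◁ B.mul := by
      rw [bar_linear_left h]; bicategory
    _ = _ := by rw [comp_bar h]; bicategory

/-- Multiplying by elements of `A` (with the unit of `B`) is `bar` followed by the `A`-action. -/
lemma whiskerLeft_unit_wreathMul (h : IsWeakDistribLaw A B Ψ) :
    ((A.t ◁ B.unit) ▷ (A.t ≫ B.t)) ≫ wreathMul A B Ψ =
      (ρ_ A.t).hom ▷ (A.t ≫ B.t) ≫ A.t ◁ bar A B Ψ ≫ (α_ _ _ _).inv ≫ A.mul ▷ B.t := by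
  rw [bar_eq h]
  unfold wreathMul
  calc
    _ = 𝟙 _ ⊗≫ A.t ◁ B.unit ▷ A.t ▷ B.t ⊗≫ A.t ◁ Ψ ▷ B.t ⊗≫
          (A.mul ▷ (B.t ≫ B.t) ≫ A.t ◁ B.mul) := by bicategory
    _ = _ := by rw [← whisker_exchange]; bicategory

/-- Multiplying by elements of `B` (with the unit of `A`) is `bar` followed by the `B`-action. -/
lemma whiskerRight_unit_wreathMul (h : IsWeakDistribLaw A B Ψ) :
    ((A.t ≫ B.t) ◁ (A.unit ▷ B.t)) ≫ wreathMul A B Ψ =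
      (A.t ≫ B.t) ◁ (λ_ B.t).hom ≫ bar A B Ψ ▷ B.t ≫ (α_ _ _ _).hom ≫ A.t ◁ B.mul := by
  rw [bar_eq_left h]
  unfold wreathMul
  bicategory

/-- The weak wreath product `B ⊗ A` before splitting: a weak distributive law makes `wreathMul`
associative, with preunit `η_B ⊗ η_A` and idempotent `bar`. -/
def wreathPreMonad (h : IsWeakDistribLaw A B Ψ) : PreMonad X where
  t := A.t ≫ B.t
  mul := wreathMul A B Ψ
  unit := A.unit ≫ (ρ_ A.t).inv ≫ A.t ◁ B.unit
  idem := bar A B Ψ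
  assoc := wreathMul_assoc h
  unit_left := by
    calc
      _ = 𝟙 _ ⊗≫ A.unit ▷ (A.t ≫ B.t) ⊗≫
            ((A.t ◁ B.unit) ▷ (A.t ≫ B.t) ≫ wreathMul A B Ψ) := by bicategory
      _ = 𝟙 _ ⊗≫ (A.unit ▷ (A.t ≫ B.t) ≫ A.t ◁ bar A B Ψ) ⊗≫ A.mul ▷ B.t := by
        rw [whiskerLeft_unit_wreathMul h]; bicategory
      _ = 𝟙 _ ⊗≫ bar A B Ψ ⊗≫ (A.unit ▷ A.t ≫ A.mul) ▷ B.t := by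
        rw [← whisker_exchange]; bicategory
      _ = _ := by rw [A.unit_left]; bicategory
  unit_right := by
    calc
      _ = 𝟙 _ ⊗≫ (A.t ≫ B.t) ◁ (A.unit ▷ 𝟙 X ≫ A.t ◁ B.unit) ⊗≫ wreathMul A B Ψ := by
        bicategory
      _ = 𝟙 _ ⊗≫ (A.t ≫ B.t) ◁ B.unit ⊗≫
            ((A.t ≫ B.t) ◁ (A.unit ▷ B.t) ≫ wreathMul A B Ψ) := by
        rw [← whisker_exchange]; bicategory
      _ = 𝟙 _ ⊗≫ ((A.t ≫ B.t) ◁ B.unit ≫ bar A B Ψ ▷ B.t) ⊗≫ A.t ◁ B.mul := by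
        rw [whiskerRight_unit_wreathMul h]; bicategory
      _ = 𝟙 _ ⊗≫ bar A B Ψ ⊗≫ A.t ◁ (B.t ◁ B.unit ≫ B.mul) := by
        rw [whisker_exchange]; bicategory
      _ = _ := by rw [B.unit_right]; bicategory
  mul_idem := wreathMul_comp_bar h

end

/-! ### The factorization structure of a weak distributive law -/

section
variable {X : K} {A B R : BMonad X} {Ψ : B.t ≫ A.t ⟶ A.t ≫ B.t}
  {i : R.t ⟶ A.t ≫ B.t} {p : A.t ≫ B.t ⟶ R.t} {h : IsWeakDistribLaw A B Ψ}

/-- The 2-cell `A ⟶ R`, `π (η_B ⊗ A)`, attached to a 2-cell `π : B ⊗ A ⟶ R`. -/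
def inclLeft (B : BMonad X) (p : A.t ≫ B.t ⟶ R.t) : A.t ⟶ R.t :=
  (ρ_ A.t).inv ≫ A.t ◁ B.unit ≫ p

/-- The 2-cell `B ⟶ R`, `π (B ⊗ η_A)`, attached to a 2-cell `π : B ⊗ A ⟶ R`. -/
def inclRight (A : BMonad X) (p : A.t ≫ B.t ⟶ R.t) : B.t ⟶ R.t :=
  (λ_ B.t).inv ≫ A.unit ▷ B.t ≫ p

variable (S : (wreathPreMonad h).IsSplitting R i p)
include S

lemma factProj_of_isSplitting : factProj A B R (inclLeft B p) (inclRight A p) = p := by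
  have hm : p ▷ (A.t ≫ B.t) ≫ R.t ◁ p ≫ R.mul = wreathMul A B Ψ ≫ p := S.proj_mul
  have hp : bar A B Ψ ≫ p = p := S.idem_proj
  unfold factProj inclLeft inclRight
  calc
    _ = 𝟙 _ ⊗≫ A.t ◁ B.unit ▷ B.t ⊗≫ (p ▷ (𝟙 X ≫ B.t) ≫ R.t ◁ (A.unit ▷ B.t)) ⊗≫ R.t ◁ p ⊗≫
          R.mul := by bicategory
    _ = 𝟙 _ ⊗≫ A.t ◁ B.unit ▷ B.t ⊗≫ (A.t ≫ B.t) ◁ (A.unit ▷ B.t) ⊗≫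
          (p ▷ (A.t ≫ B.t) ≫ R.t ◁ p ≫ R.mul) := by
      rw [← whisker_exchange]; bicategory
    _ = 𝟙 _ ⊗≫ A.t ◁ B.unit ▷ B.t ⊗≫
          ((A.t ≫ B.t) ◁ (A.unit ▷ B.t) ≫ wreathMul A B Ψ) ≫ p := by
      rw [hm]; bicategory
    _ = 𝟙 _ ⊗≫ (A.t ◁ B.unit) ▷ B.t ⊗≫ bar A B Ψ ▷ B.t ⊗≫ A.t ◁ B.mul ≫ p := by
      rw [whiskerRight_unit_wreathMul h]; bicategory
    _ = 𝟙 _ ⊗≫ A.t ◁ B.unit ▷ B.t ⊗≫ ((α_ A.t B.t B.t).inv ≫ bar A B Ψ ▷ B.t ≫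
          (α_ A.t B.t B.t).hom ≫ A.t ◁ B.mul) ≫ p := by bicategory
    _ = 𝟙 _ ⊗≫ A.t ◁ (B.unit ▷ B.t ≫ B.mul) ⊗≫ bar A B Ψ ≫ p := by
      rw [← bar_linear h]; bicategory
    _ = _ := by
      rw [B.unit_left, hp]; bicategory

/-- The inclusion `i : R ⟶ B ⊗ A` is linear over `A`. -/
lemma inclLeft_mul_incl : inclLeft B p ▷ R.t ≫ R.mul ≫ i =
    A.t ◁ i ≫ (α_ A.t A.t B.t).inv ≫ A.mul ▷ B.t := by
  have hm : R.mul ≫ i = i ▷ R.t ≫ (A.t ≫ B.t) ◁ i ≫ wreathMul A B Ψ := S.mul_incl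
  have he : p ≫ i = bar A B Ψ := S.proj_incl
  have hi : i ≫ bar A B Ψ = i := S.incl_idem
  have hb : bar A B Ψ ▷ (A.t ≫ B.t) ≫ wreathMul A B Ψ = wreathMul A B Ψ :=
    (wreathPreMonad h).idem_whiskerRight_mul
  unfold inclLeft
  calc
    _ = 𝟙 _ ⊗≫ (A.t ◁ B.unit) ▷ R.t ≫ ((p ≫ i) ▷ R.t ≫ (A.t ≫ B.t) ◁ i) ≫ wreathMul A B Ψ := by
      rw [hm]; bicategory
    _ = 𝟙 _ ⊗≫ ((A.t ◁ B.unit) ▷ R.t ≫ (A.t ≫ B.t) ◁ i) ≫ wreathMul A B Ψ := by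
      rw [he, ← whisker_exchange, Category.assoc, hb]; bicategory
    _ = 𝟙 _ ⊗≫ (A.t ≫ 𝟙 X) ◁ i ≫ (A.t ◁ B.unit) ▷ (A.t ≫ B.t) ≫ wreathMul A B Ψ := by
      rw [← whisker_exchange]; bicategory
    _ = 𝟙 _ ⊗≫ A.t ◁ (i ≫ bar A B Ψ) ⊗≫ A.mul ▷ B.t := by
      rw [whiskerLeft_unit_wreathMul h]; bicategory
    _ = _ := by rw [hi]; bicategory

/-- The inclusion `i : R ⟶ B ⊗ A` is linear over `B`. -/
lemma inclRight_mul_incl : R.t ◁ inclRight A p ≫ R.mul ≫ i =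
    i ▷ B.t ≫ (α_ A.t B.t B.t).hom ≫ A.t ◁ B.mul := by
  have hm : R.mul ≫ i = i ▷ R.t ≫ (A.t ≫ B.t) ◁ i ≫ wreathMul A B Ψ := S.mul_incl
  have he : p ≫ i = bar A B Ψ := S.proj_incl
  have hi : i ≫ bar A B Ψ = i := S.incl_idem
  have hb : (A.t ≫ B.t) ◁ bar A B Ψ ≫ wreathMul A B Ψ = wreathMul A B Ψ :=
    (wreathPreMonad h).idem_whiskerLeft_mul
  unfold inclRight
  calc
    _ = 𝟙 _ ⊗≫ R.t ◁ (A.unit ▷ B.t) ≫ (R.t ◁ p ≫ i ▷ R.t) ≫ (A.t ≫ B.t) ◁ i ≫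
          wreathMul A B Ψ := by
      rw [hm]; bicategory
    _ = 𝟙 _ ⊗≫ (R.t ◁ (A.unit ▷ B.t) ≫ i ▷ (A.t ≫ B.t)) ≫ (A.t ≫ B.t) ◁ (p ≫ i) ≫
          wreathMul A B Ψ := by
      rw [whisker_exchange]; bicategory
    _ = 𝟙 _ ⊗≫ i ▷ (𝟙 X ≫ B.t) ≫ (A.t ≫ B.t) ◁ (A.unit ▷ B.t) ≫ wreathMul A B Ψ := by
      rw [he, hb, whisker_exchange]; bicategory
    _ = 𝟙 _ ⊗≫ (i ≫ bar A B Ψ) ▷ B.t ⊗≫ A.t ◁ B.mul := by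
      rw [whiskerRight_unit_wreathMul h]; bicategory
    _ = _ := by rw [hi]; bicategory

lemma isMonadMap_inclLeft : IsMonadMap A R (inclLeft B p) where
  mul := by
    have : Mono i := S.incl_mono
    have he : p ≫ i = bar A B Ψ := S.proj_incl
    have hα := inclLeft_mul_incl S
    rw [← cancel_mono i]
    calc
      _ = 𝟙 _ ⊗≫ (A.mul ▷ 𝟙 X ≫ A.t ◁ B.unit) ⊗≫ (p ≫ i) := by
        unfold inclLeft; bicategory
      _ = 𝟙 _ ⊗≫ A.t ◁ A.t ◁ B.unit ⊗≫ (A.mul ▷ B.t ≫ bar A B Ψ) := by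
        rw [he, ← whisker_exchange]; bicategory
      _ = 𝟙 _ ⊗≫ A.t ◁ A.t ◁ B.unit ⊗≫ A.t ◁ (p ≫ i) ⊗≫ A.mul ▷ B.t := by
        rw [bar_linear_left h, he]; bicategory
      _ = A.t ◁ inclLeft B p ≫ (A.t ◁ i ≫ (α_ A.t A.t B.t).inv ≫ A.mul ▷ B.t) := by
        unfold inclLeft; bicategory
      _ = _ := by
        rw [← hα, whisker_exchange_assoc]; simp only [Category.assoc]
  unit := by
    have hu : R.unit = (A.unit ≫ (ρ_ A.t).inv ≫ A.t ◁ B.unit) ≫ p := S.unit_eq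
    rw [hu]
    unfold inclLeft
    bicategory

lemma isMonadMap_inclRight : IsMonadMap B R (inclRight A p) where
  mul := by
    have : Mono i := S.incl_mono
    have he : p ≫ i = bar A B Ψ := S.proj_incl
    have hβ := inclRight_mul_incl S
    rw [← cancel_mono i]
    symm
    calc
      _ = inclRight A p ▷ B.t ≫ (i ▷ B.t ≫ (α_ A.t B.t B.t).hom ≫ A.t ◁ B.mul) := by
        rw [← hβ]; simp only [Category.assoc]
      _ = 𝟙 _ ⊗≫ A.unit ▷ B.t ▷ B.t ⊗≫ ((α_ A.t B.t B.t).inv ≫ (p ≫ i) ▷ B.t ≫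
            (α_ A.t B.t B.t).hom ≫ A.t ◁ B.mul) := by
        unfold inclRight; bicategory
      _ = 𝟙 _ ⊗≫ (A.unit ▷ (B.t ≫ B.t) ≫ A.t ◁ B.mul) ⊗≫ (p ≫ i) := by
        rw [he, ← bar_linear h]; bicategory
      _ = _ := by rw [← whisker_exchange]; unfold inclRight; bicategory
  unit := by
    have hu : R.unit = (A.unit ≫ (ρ_ A.t).inv ≫ A.t ◁ B.unit) ≫ p := S.unit_eq
    rw [hu]
    unfold inclRight
    calc
      _ = 𝟙 _ ⊗≫ (𝟙 X ◁ B.unit ≫ A.unit ▷ B.t) ≫ p := by bicategory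
      _ = _ := by rw [whisker_exchange]; bicategory

lemma isBilinFact_of_isSplitting : IsBilinFact A B R (inclLeft B p) (inclRight A p) i where
  alpha := isMonadMap_inclLeft S
  beta := isMonadMap_inclRight S
  iota_right := inclLeft_mul_incl S
  iota_left := inclRight_mul_incl S
  iota_proj := by
    rw [factProj_of_isSplitting S]
    exact S.incl_proj

lemma factPsi_of_isSplitting : factPsi A B R (inclLeft B p) (inclRight A p) i = Ψ := by
  have hm : p ▷ (A.t ≫ B.t) ≫ R.t ◁ p ≫ R.mul ≫ i = wreathMul A B Ψ := S.proj_mul_incl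
  unfold factPsi inclLeft inclRight
  calc
    _ = 𝟙 _ ⊗≫ (A.unit ▷ B.t) ▷ A.t ⊗≫ (p ▷ (A.t ≫ 𝟙 X) ≫ R.t ◁ (A.t ◁ B.unit)) ⊗≫
          R.t ◁ p ⊗≫ R.mul ≫ i := by bicategory
    _ = 𝟙 _ ⊗≫ (A.unit ▷ B.t) ▷ A.t ⊗≫ (A.t ≫ B.t) ◁ (A.t ◁ B.unit) ⊗≫
          (p ▷ (A.t ≫ B.t) ≫ R.t ◁ p ≫ R.mul ≫ i) := by
      rw [← whisker_exchange]; bicategory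
    _ = 𝟙 _ ⊗≫ A.unit ▷ (B.t ≫ A.t) ⊗≫ A.t ◁ ((B.t ≫ A.t) ◁ B.unit ≫ Ψ ▷ B.t) ⊗≫
          A.mul ▷ (B.t ≫ B.t) ⊗≫ A.t ◁ B.mul := by
      rw [hm, wreathMul]; bicategory
    _ = 𝟙 _ ⊗≫ (A.unit ▷ (B.t ≫ A.t) ≫ A.t ◁ Ψ) ⊗≫
          (A.mul ▷ (B.t ≫ 𝟙 X) ≫ A.t ◁ (B.t ◁ B.unit)) ⊗≫ A.t ◁ B.mul := by
      rw [whisker_exchange, ← whisker_exchange A.mul]; bicategory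
    _ = 𝟙 _ ⊗≫ Ψ ⊗≫ (A.unit ▷ A.t ≫ A.mul) ▷ B.t ⊗≫ A.t ◁ (B.t ◁ B.unit ≫ B.mul) := by
      rw [← whisker_exchange A.unit]; bicategory
    _ = _ := by rw [A.unit_left, B.unit_right]; bicategory
end

/-- The functor to weak distributive laws is even strictly surjective on 0-cells: `Ψ` is recovered on
the nose from any splitting of its idempotent `bar A B Ψ`. -/
lemma toWdl_obj_surjective (hK : ∀ X : K, IsIdempotentComplete (X ⟶ X)) (Y : Wdl K) :
    ∃ P : Bf K, (toWdl K).obj P = Y := by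
  obtain ⟨X, A, B, Ψ, h⟩ := Y
  obtain ⟨r, i, p, hr, he⟩ := (hK X).idempotents_split _ _ (wreathPreMonad h).idem_idem
  have S := (wreathPreMonad h).isSplitting_split hr he
  refine ⟨⟨X, A, B, (wreathPreMonad h).split hr he, inclLeft B p, inclRight A p, i,
    isBilinFact_of_isSplitting S⟩, ?_⟩
  have := factPsi_of_isSplitting S
  dsimp only [toWdl]
  congr 1

/-! ### Extending monad morphisms along a factorization -/

section
variable {X : K} {A B R : BMonad X} {a : A.t ⟶ R.t} {b : B.t ⟶ R.t} {i : R.t ⟶ A.t ≫ B.t}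

/-- The 2-cell `π : B ⊗ A ⟶ R` is linear over `A`. -/
lemma mul_factProj (h : IsBilinFact A B R a b i) : A.mul ▷ B.t ≫ factProj A B R a b =
    (α_ A.t A.t B.t).hom ≫ A.t ◁ factProj A B R a b ≫ a ▷ R.t ≫ R.mul := by
  unfold factProj
  calc
    _ = 𝟙 _ ⊗≫ (A.mul ≫ a) ▷ B.t ⊗≫ R.t ◁ b ⊗≫ R.mul := by bicategory
    _ = 𝟙 _ ⊗≫ a ▷ A.t ▷ B.t ⊗≫ R.t ◁ a ▷ B.t ⊗≫ (R.mul ▷ B.t ≫ R.t ◁ b) ⊗≫ R.mul := by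
      rw [h.alpha.mul]; bicategory
    _ = 𝟙 _ ⊗≫ a ▷ A.t ▷ B.t ⊗≫ R.t ◁ a ▷ B.t ⊗≫ R.t ◁ R.t ◁ b ⊗≫ (R.mul ▷ R.t ≫ R.mul) := by
      rw [← whisker_exchange]; bicategory
    _ = 𝟙 _ ⊗≫ (a ▷ (A.t ≫ B.t) ≫ R.t ◁ (a ▷ B.t ≫ R.t ◁ b ≫ R.mul)) ⊗≫ R.mul := by
      rw [R.assoc]; bicategory
    _ = _ := by rw [← whisker_exchange]; bicategory

/-- The 2-cell `π : B ⊗ A ⟶ R` is linear over `B`. -/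
lemma mul_factProj_right (h : IsBilinFact A B R a b i) : A.t ◁ B.mul ≫ factProj A B R a b =
    (α_ A.t B.t B.t).inv ≫ factProj A B R a b ▷ B.t ≫ R.t ◁ b ≫ R.mul := by
  unfold factProj
  calc
    _ = 𝟙 _ ⊗≫ (A.t ◁ B.mul ≫ a ▷ B.t) ⊗≫ R.t ◁ b ⊗≫ R.mul := by bicategory
    _ = 𝟙 _ ⊗≫ a ▷ (B.t ≫ B.t) ⊗≫ R.t ◁ (B.mul ≫ b) ⊗≫ R.mul := by
      rw [whisker_exchange]; bicategory
    _ = 𝟙 _ ⊗≫ a ▷ (B.t ≫ B.t) ⊗≫ R.t ◁ b ▷ B.t ⊗≫ R.t ◁ R.t ◁ b ⊗≫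
          ((α_ _ _ _).hom ≫ R.t ◁ R.mul ≫ R.mul) := by
      rw [h.beta.mul]; bicategory
    _ = 𝟙 _ ⊗≫ a ▷ (B.t ≫ B.t) ⊗≫ R.t ◁ b ▷ B.t ⊗≫ ((R.t ≫ R.t) ◁ b ≫ R.mul ▷ R.t) ⊗≫
          R.mul := by
      rw [← R.assoc]; bicategory
    _ = _ := by rw [whisker_exchange]; bicategory

lemma unit_factProj (h : IsBilinFact A B R a b i) :
    (ρ_ A.t).inv ≫ A.t ◁ B.unit ≫ factProj A B R a b = a := by
  unfold factProj
  calc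
    _ = 𝟙 _ ⊗≫ (A.t ◁ B.unit ≫ a ▷ B.t) ⊗≫ R.t ◁ b ⊗≫ R.mul := by bicategory
    _ = 𝟙 _ ⊗≫ a ⊗≫ R.t ◁ (B.unit ≫ b) ⊗≫ R.mul := by rw [whisker_exchange]; bicategory
    _ = 𝟙 _ ⊗≫ a ⊗≫ (R.t ◁ R.unit ≫ R.mul) := by rw [h.beta.unit]; bicategory
    _ = _ := by rw [R.unit_right]; bicategory

lemma unit_factProj_right (h : IsBilinFact A B R a b i) :
    (λ_ B.t).inv ≫ A.unit ▷ B.t ≫ factProj A B R a b = b := by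
  unfold factProj
  calc
    _ = 𝟙 _ ⊗≫ (A.unit ≫ a) ▷ B.t ⊗≫ R.t ◁ b ⊗≫ R.mul := by bicategory
    _ = 𝟙 _ ⊗≫ (R.unit ▷ B.t ≫ R.t ◁ b) ⊗≫ R.mul := by rw [h.alpha.unit]; bicategory
    _ = 𝟙 _ ⊗≫ b ⊗≫ (R.unit ▷ R.t ≫ R.mul) := by rw [← whisker_exchange]; bicategory
    _ = _ := by rw [R.unit_left]; bicategory

lemma factPsi_factProj (h : IsBilinFact A B R a b i) :
    factPsi A B R a b i ≫ factProj A B R a b = b ▷ A.t ≫ R.t ◁ a ≫ R.mul := by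
  unfold factPsi
  simp only [Category.assoc, h.iota_proj, Category.comp_id]

lemma bar_factProj (h : IsBilinFact A B R a b i) :
    bar A B (factPsi A B R a b i) ≫ factProj A B R a b = factProj A B R a b := by
  rw [bar_factPsi h, Category.assoc, h.iota_proj, Category.comp_id]

/-- Multiplying two factorized elements of `R`: the inner factors `b`, `a` are multiplied first, and
the outer factors act on the result. -/
lemma factProj_mul :
    factProj A B R a b ▷ (A.t ≫ B.t) ≫ R.t ◁ factProj A B R a b ≫ R.mul =
      𝟙 _ ⊗≫ A.t ◁ (b ▷ A.t ≫ R.t ◁ a ≫ R.mul) ▷ B.t ⊗≫ A.t ◁ (R.t ◁ b ≫ R.mul) ⊗≫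
        a ▷ R.t ⊗≫ R.mul := by
  unfold factProj
  calc
    _ = 𝟙 _ ⊗≫ a ▷ B.t ▷ A.t ▷ B.t ⊗≫ R.t ◁ b ▷ A.t ▷ B.t ⊗≫
          (R.mul ▷ (A.t ≫ B.t) ≫ R.t ◁ (a ▷ B.t ≫ R.t ◁ b ≫ R.mul)) ⊗≫ R.mul := by bicategory
    _ = 𝟙 _ ⊗≫ a ▷ B.t ▷ A.t ▷ B.t ⊗≫ R.t ◁ b ▷ A.t ▷ B.t ⊗≫
          R.t ◁ R.t ◁ a ▷ B.t ⊗≫ R.t ◁ R.t ◁ R.t ◁ b ⊗≫ R.t ◁ R.t ◁ R.mul ⊗≫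
          (R.mul ▷ R.t ≫ R.mul) := by
      rw [← whisker_exchange]; bicategory
    _ = 𝟙 _ ⊗≫ a ▷ B.t ▷ A.t ▷ B.t ⊗≫ R.t ◁ b ▷ A.t ▷ B.t ⊗≫
          R.t ◁ R.t ◁ a ▷ B.t ⊗≫ R.t ◁ R.t ◁ R.t ◁ b ⊗≫
          R.t ◁ ((α_ _ _ _).hom ≫ R.t ◁ R.mul ≫ R.mul) ⊗≫ R.mul := by
      rw [R.assoc]; bicategory
    _ = 𝟙 _ ⊗≫ a ▷ B.t ▷ A.t ▷ B.t ⊗≫ R.t ◁ b ▷ A.t ▷ B.t ⊗≫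
          R.t ◁ R.t ◁ a ▷ B.t ⊗≫ R.t ◁ ((R.t ≫ R.t) ◁ b ≫ R.mul ▷ R.t) ⊗≫
          R.t ◁ R.mul ⊗≫ R.mul := by
      rw [← R.assoc]; bicategory
    _ = 𝟙 _ ⊗≫ (a ▷ (B.t ≫ A.t ≫ B.t) ≫ R.t ◁ ((α_ _ _ _).inv ≫
          (b ▷ A.t ≫ R.t ◁ a ≫ R.mul) ▷ B.t ≫ R.t ◁ b ≫ R.mul)) ⊗≫ R.mul := by
      rw [whisker_exchange]; bicategory
    _ = _ := by rw [← whisker_exchange]; bicategory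
end

section
variable {X X' : K} {A B R : BMonad X} {a : A.t ⟶ R.t} {b : B.t ⟶ R.t} {i : R.t ⟶ A.t ≫ B.t}
  {A' B' R' : BMonad X'} {a' : A'.t ⟶ R'.t} {b' : B'.t ⟶ R'.t} {i' : R'.t ⟶ A'.t ≫ B'.t}
  {V : X ⟶ X'}

/-- The 2-cell `(ζ ⊗ A) (B' ⊗ ξ) : B' ⊗ A' ⊗ V ⟶ V ⊗ B ⊗ A`. -/
def pairCell (ξ : MonadHom A A' V) (ζ : MonadHom B B' V) :
    V ≫ A'.t ≫ B'.t ⟶ (A.t ≫ B.t) ≫ V :=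
  (α_ V A'.t B'.t).inv ≫ ξ.cell ▷ B'.t ≫ (α_ A.t V B'.t).hom ≫ A.t ◁ ζ.cell ≫
    (α_ A.t B.t V).inv

/-- The 2-cell `(V ⊗ π) (ζ ⊗ A) (B' ⊗ ξ) (ι' ⊗ V) : R' ⊗ V ⟶ V ⊗ R` restricts along `π'` to
`(V ⊗ π) (ζ ⊗ A) (B' ⊗ ξ)`, because `(ξ, ζ)` absorbs the idempotent `ι' π'`. -/
lemma factProj_iota_pairCell
    {ξ : MonadHom A A' V} {ζ : MonadHom B B' V}
    (h : IsBilinFact A B R a b i) (h' : IsBilinFact A' B' R' a' b' i')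
    (H : IsWdlHom (factPsi A B R a b i) (factPsi A' B' R' a' b' i') ξ ζ) :
    V ◁ factProj A' B' R' a' b' ≫ V ◁ i' ≫ pairCell ξ ζ ≫ factProj A B R a b ▷ V =
      pairCell ξ ζ ≫ factProj A B R a b ▷ V := by
  have hab := H.absorb (factPsi_isWeakDistribLaw h) (factPsi_isWeakDistribLaw h')
  have e : factProj A B R a b ▷ V =
      bar A B (factPsi A B R a b i) ▷ V ≫ factProj A B R a b ▷ V := by
    rw [← comp_whiskerRight, bar_factProj h]
  unfold pairCell
  rw [← whiskerLeft_comp_assoc, ← bar_factPsi h', e]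
  simpa only [Category.assoc] using congrArg (· ≫ factProj A B R a b ▷ V) hab

/-- Compatibility of `(ξ, ζ)` with the weak distributive laws says that the induced 2-cell
`R' ⊗ V ⟶ V ⊗ R` is multiplicative on the products `α' β'` taken in the order that does not factorize. -/
lemma crossing_iota_pairCell
    {ξ : MonadHom A A' V} {ζ : MonadHom B B' V}
    (h : IsBilinFact A B R a b i) (h' : IsBilinFact A' B' R' a' b' i')
    (H : IsWdlHom (factPsi A B R a b i) (factPsi A' B' R' a' b' i') ξ ζ) :
    V ◁ (b' ▷ A'.t ≫ R'.t ◁ a' ≫ R'.mul) ≫ V ◁ i' ≫ pairCell ξ ζ ≫ factProj A B R a b ▷ V =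
      pairCell ζ ξ ≫ (b ▷ A.t ≫ R.t ◁ a ≫ R.mul) ▷ V := by
  rw [← factPsi_factProj h, ← factPsi_factProj h', whiskerLeft_comp, Category.assoc,
    factProj_iota_pairCell h h' H, ← bar_factProj h, comp_whiskerRight, comp_whiskerRight,
    bar_factProj h]
  unfold IsWdlHom at H
  unfold pairCell
  simpa only [Category.assoc] using congrArg (· ≫ factProj A B R a b ▷ V) H.symm

/-- A 2-cell `ρ` with `ρ π' = π (ξ, ζ)` is compatible with the actions of `A'` and `A`. -/
lemma extension_mul_left
    {ξ : MonadHom A A' V} {ζ : MonadHom B B' V} {ρ : V ≫ R'.t ⟶ R.t ≫ V}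
    (h : IsBilinFact A B R a b i) (h' : IsBilinFact A' B' R' a' b' i')
    (hρ : V ◁ factProj A' B' R' a' b' ≫ ρ = pairCell ξ ζ ≫ factProj A B R a b ▷ V) :
    V ◁ (a' ▷ R'.t ≫ R'.mul) ≫ ρ =
      𝟙 _ ⊗≫ ξ.cell ▷ R'.t ⊗≫ A.t ◁ ρ ⊗≫ (a ▷ R.t ≫ R.mul) ▷ V := by
  have he : V ◁ A'.t ◁ i' ≫ V ◁ A'.t ◁ factProj A' B' R' a' b' = 𝟙 _ := by
    simp only [← whiskerLeft_comp, h'.iota_proj, whiskerLeft_id]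
  have : Epi (V ◁ A'.t ◁ factProj A' B' R' a' b') := (SplitEpi.mk _ he).epi
  rw [← cancel_epi (V ◁ A'.t ◁ factProj A' B' R' a' b')]
  calc
    _ = 𝟙 _ ⊗≫ V ◁ ((α_ _ _ _).hom ≫ A'.t ◁ factProj A' B' R' a' b' ≫ a' ▷ R'.t ≫ R'.mul) ≫
          ρ := by bicategory
    _ = 𝟙 _ ⊗≫ V ◁ A'.mul ▷ B'.t ≫ (V ◁ factProj A' B' R' a' b' ≫ ρ) := by
      rw [← mul_factProj h']; bicategory
    _ = 𝟙 _ ⊗≫ (V ◁ A'.mul ≫ ξ.cell) ▷ B'.t ⊗≫ A.t ◁ ζ.cell ⊗≫ factProj A B R a b ▷ V := by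
      rw [hρ, pairCell]; bicategory
    _ = 𝟙 _ ⊗≫ ξ.cell ▷ A'.t ▷ B'.t ⊗≫ A.t ◁ ξ.cell ▷ B'.t ⊗≫
          (A.mul ▷ (V ≫ B'.t) ≫ A.t ◁ ζ.cell) ⊗≫ factProj A B R a b ▷ V := by
      rw [ξ.mul]; bicategory
    _ = 𝟙 _ ⊗≫ ξ.cell ▷ A'.t ▷ B'.t ⊗≫ A.t ◁ ξ.cell ▷ B'.t ⊗≫
          A.t ◁ A.t ◁ ζ.cell ⊗≫ (A.mul ▷ B.t ≫ factProj A B R a b) ▷ V := by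
      rw [← whisker_exchange]; bicategory
    _ = 𝟙 _ ⊗≫ ξ.cell ▷ (A'.t ≫ B'.t) ⊗≫ A.t ◁ (pairCell ξ ζ ≫ factProj A B R a b ▷ V) ⊗≫
          (a ▷ R.t ≫ R.mul) ▷ V := by
      rw [mul_factProj h, pairCell]; bicategory
    _ = 𝟙 _ ⊗≫ (ξ.cell ▷ (A'.t ≫ B'.t) ≫ (A.t ≫ V) ◁ factProj A' B' R' a' b') ⊗≫ A.t ◁ ρ ⊗≫
          (a ▷ R.t ≫ R.mul) ▷ V := by
      rw [← hρ]; bicategory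
    _ = _ := by rw [← whisker_exchange]; bicategory

/-- A 2-cell `ρ` with `ρ π' = π (ξ, ζ)` is compatible with the actions of `B'` and `B`. -/
lemma extension_mul_right
    {ξ : MonadHom A A' V} {ζ : MonadHom B B' V} {ρ : V ≫ R'.t ⟶ R.t ≫ V}
    (h : IsBilinFact A B R a b i) (h' : IsBilinFact A' B' R' a' b' i')
    (hρ : V ◁ factProj A' B' R' a' b' ≫ ρ = pairCell ξ ζ ≫ factProj A B R a b ▷ V) :
    V ◁ (R'.t ◁ b' ≫ R'.mul) ≫ ρ =
      𝟙 _ ⊗≫ ρ ▷ B'.t ⊗≫ R.t ◁ ζ.cell ⊗≫ (R.t ◁ b ≫ R.mul) ▷ V := by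
  have he : V ◁ i' ▷ B'.t ≫ V ◁ factProj A' B' R' a' b' ▷ B'.t = 𝟙 _ := by
    simp only [← whiskerLeft_comp, ← comp_whiskerRight, h'.iota_proj, whiskerLeft_id,
      id_whiskerRight]
  have : Epi (V ◁ factProj A' B' R' a' b' ▷ B'.t) := (SplitEpi.mk _ he).epi
  rw [← cancel_epi (V ◁ factProj A' B' R' a' b' ▷ B'.t)]
  calc
    _ = 𝟙 _ ⊗≫ V ◁ ((α_ _ _ _).inv ≫ factProj A' B' R' a' b' ▷ B'.t ≫ R'.t ◁ b' ≫ R'.mul) ≫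
          ρ := by bicategory
    _ = 𝟙 _ ⊗≫ V ◁ A'.t ◁ B'.mul ≫ (V ◁ factProj A' B' R' a' b' ≫ ρ) := by
      rw [← mul_factProj_right h']; bicategory
    _ = 𝟙 _ ⊗≫ ((V ≫ A'.t) ◁ B'.mul ≫ ξ.cell ▷ B'.t) ⊗≫ A.t ◁ ζ.cell ⊗≫
          factProj A B R a b ▷ V := by
      rw [hρ, pairCell]; bicategory
    _ = 𝟙 _ ⊗≫ ξ.cell ▷ (B'.t ≫ B'.t) ⊗≫ A.t ◁ (V ◁ B'.mul ≫ ζ.cell) ⊗≫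
          factProj A B R a b ▷ V := by
      rw [whisker_exchange]; bicategory
    _ = 𝟙 _ ⊗≫ ξ.cell ▷ (B'.t ≫ B'.t) ⊗≫ A.t ◁ ζ.cell ▷ B'.t ⊗≫ A.t ◁ B.t ◁ ζ.cell ⊗≫
          (A.t ◁ B.mul ≫ factProj A B R a b) ▷ V := by
      rw [ζ.mul]; bicategory
    _ = 𝟙 _ ⊗≫ pairCell ξ ζ ▷ B'.t ⊗≫
          ((A.t ≫ B.t) ◁ ζ.cell ≫ factProj A B R a b ▷ (B.t ≫ V)) ⊗≫
          (R.t ◁ b ≫ R.mul) ▷ V := by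
      rw [mul_factProj_right h, pairCell]; bicategory
    _ = 𝟙 _ ⊗≫ (pairCell ξ ζ ≫ factProj A B R a b ▷ V) ▷ B'.t ⊗≫ R.t ◁ ζ.cell ⊗≫
          (R.t ◁ b ≫ R.mul) ▷ V := by
      rw [whisker_exchange]; bicategory
    _ = _ := by rw [← hρ]; bicategory

lemma extension_comm_alpha
    {ξ : MonadHom A A' V} {ζ : MonadHom B B' V} {ρ : V ≫ R'.t ⟶ R.t ≫ V}
    (h : IsBilinFact A B R a b i) (h' : IsBilinFact A' B' R' a' b' i')
    (hρ : V ◁ factProj A' B' R' a' b' ≫ ρ = pairCell ξ ζ ≫ factProj A B R a b ▷ V) :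
    V ◁ a' ≫ ρ = ξ.cell ≫ a ▷ V := by
  calc
    _ = V ◁ ((ρ_ A'.t).inv ≫ A'.t ◁ B'.unit ≫ factProj A' B' R' a' b') ≫ ρ := by
      rw [unit_factProj h']
    _ = 𝟙 _ ⊗≫ V ◁ A'.t ◁ B'.unit ≫ (V ◁ factProj A' B' R' a' b' ≫ ρ) := by bicategory
    _ = 𝟙 _ ⊗≫ ((V ≫ A'.t) ◁ B'.unit ≫ ξ.cell ▷ B'.t) ⊗≫ A.t ◁ ζ.cell ⊗≫
          factProj A B R a b ▷ V := by
      rw [hρ, pairCell]; bicategory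
    _ = 𝟙 _ ⊗≫ ξ.cell ⊗≫ A.t ◁ ((ρ_ V).inv ≫ V ◁ B'.unit ≫ ζ.cell) ⊗≫
          factProj A B R a b ▷ V := by
      rw [whisker_exchange]; bicategory
    _ = 𝟙 _ ⊗≫ ξ.cell ⊗≫ ((ρ_ A.t).inv ≫ A.t ◁ B.unit ≫ factProj A B R a b) ▷ V := by
      rw [ζ.unit]; bicategory
    _ = _ := by rw [unit_factProj h]; bicategory

lemma extension_comm_beta
    {ξ : MonadHom A A' V} {ζ : MonadHom B B' V} {ρ : V ≫ R'.t ⟶ R.t ≫ V}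
    (h : IsBilinFact A B R a b i) (h' : IsBilinFact A' B' R' a' b' i')
    (hρ : V ◁ factProj A' B' R' a' b' ≫ ρ = pairCell ξ ζ ≫ factProj A B R a b ▷ V) :
    V ◁ b' ≫ ρ = ζ.cell ≫ b ▷ V := by
  calc
    _ = V ◁ ((λ_ B'.t).inv ≫ A'.unit ▷ B'.t ≫ factProj A' B' R' a' b') ≫ ρ := by
      rw [unit_factProj_right h']
    _ = 𝟙 _ ⊗≫ V ◁ A'.unit ▷ B'.t ≫ (V ◁ factProj A' B' R' a' b' ≫ ρ) := by bicategory
    _ = 𝟙 _ ⊗≫ ((ρ_ V).inv ≫ V ◁ A'.unit ≫ ξ.cell) ▷ B'.t ⊗≫ A.t ◁ ζ.cell ⊗≫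
          factProj A B R a b ▷ V := by
      rw [hρ, pairCell]; bicategory
    _ = 𝟙 _ ⊗≫ (A.unit ▷ (V ≫ B'.t) ≫ A.t ◁ ζ.cell) ⊗≫ factProj A B R a b ▷ V := by
      rw [ξ.unit]; bicategory
    _ = 𝟙 _ ⊗≫ ζ.cell ⊗≫ ((λ_ B.t).inv ≫ A.unit ▷ B.t ≫ factProj A B R a b) ▷ V := by
      rw [← whisker_exchange]; bicategory
    _ = _ := by rw [unit_factProj_right h]; bicategory

/-- Multiplicativity of `ρ` is checked on factorized elements `(β' α') (β' α')`: linearity takes care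
of the outer factors and `hx` of the inner product `α' β'`. -/
lemma extension_mul
    {ξ : MonadHom A A' V} {ζ : MonadHom B B' V} {ρ : V ≫ R'.t ⟶ R.t ≫ V}
    (h : IsBilinFact A B R a b i) (h' : IsBilinFact A' B' R' a' b' i')
    (hρ : V ◁ factProj A' B' R' a' b' ≫ ρ = pairCell ξ ζ ≫ factProj A B R a b ▷ V)
    (hx : V ◁ (b' ▷ A'.t ≫ R'.t ◁ a' ≫ R'.mul) ≫ ρ =
      pairCell ζ ξ ≫ (b ▷ A.t ≫ R.t ◁ a ≫ R.mul) ▷ V) :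
    V ◁ R'.mul ≫ ρ = (α_ V R'.t R'.t).inv ≫ ρ ▷ R'.t ≫ (α_ R.t V R'.t).hom ≫ R.t ◁ ρ ≫
      (α_ R.t R.t V).inv ≫ R.mul ▷ V := by
  have he : V ◁ (R'.t ◁ i' ≫ i' ▷ (A'.t ≫ B'.t)) ≫
      V ◁ (factProj A' B' R' a' b' ▷ (A'.t ≫ B'.t) ≫ R'.t ◁ factProj A' B' R' a' b') = 𝟙 _ := by
    rw [← whiskerLeft_comp, Category.assoc, ← comp_whiskerRight_assoc, h'.iota_proj,
      id_whiskerRight, Category.id_comp, ← whiskerLeft_comp, h'.iota_proj, whiskerLeft_id,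
      whiskerLeft_id]
  have : Epi (V ◁ (factProj A' B' R' a' b' ▷ (A'.t ≫ B'.t) ≫
      R'.t ◁ factProj A' B' R' a' b')) := (SplitEpi.mk _ he).epi
  have hl := extension_mul_left h h' hρ
  have hr := extension_mul_right h h' hρ
  rw [← cancel_epi (V ◁ (factProj A' B' R' a' b' ▷ (A'.t ≫ B'.t) ≫
      R'.t ◁ factProj A' B' R' a' b'))]
  calc
    _ = V ◁ (factProj A' B' R' a' b' ▷ (A'.t ≫ B'.t) ≫
          R'.t ◁ factProj A' B' R' a' b' ≫ R'.mul) ≫ ρ := by bicategory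
    _ = 𝟙 _ ⊗≫ V ◁ A'.t ◁ (b' ▷ A'.t ≫ R'.t ◁ a' ≫ R'.mul) ▷ B'.t ⊗≫
          V ◁ A'.t ◁ (R'.t ◁ b' ≫ R'.mul) ⊗≫ (V ◁ (a' ▷ R'.t ≫ R'.mul) ≫ ρ) := by
      rw [factProj_mul]; bicategory
    _ = 𝟙 _ ⊗≫ ((V ≫ A'.t) ◁ ((b' ▷ A'.t ≫ R'.t ◁ a' ≫ R'.mul) ▷ B'.t ≫
          R'.t ◁ b' ≫ R'.mul) ≫ ξ.cell ▷ R'.t) ⊗≫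
          A.t ◁ ρ ⊗≫ (a ▷ R.t ≫ R.mul) ▷ V := by
      rw [hl]; bicategory
    _ = 𝟙 _ ⊗≫ ξ.cell ▷ ((B'.t ≫ A'.t) ≫ B'.t) ⊗≫
          A.t ◁ V ◁ (b' ▷ A'.t ≫ R'.t ◁ a' ≫ R'.mul) ▷ B'.t ⊗≫
          A.t ◁ (V ◁ (R'.t ◁ b' ≫ R'.mul) ≫ ρ) ⊗≫ (a ▷ R.t ≫ R.mul) ▷ V := by
      rw [whisker_exchange]; bicategory
    _ = 𝟙 _ ⊗≫ ξ.cell ▷ ((B'.t ≫ A'.t) ≫ B'.t) ⊗≫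
          A.t ◁ (V ◁ (b' ▷ A'.t ≫ R'.t ◁ a' ≫ R'.mul) ≫ ρ) ▷ B'.t ⊗≫
          A.t ◁ R.t ◁ ζ.cell ⊗≫ A.t ◁ (R.t ◁ b ≫ R.mul) ▷ V ⊗≫ (a ▷ R.t ≫ R.mul) ▷ V := by
      rw [hr]; bicategory
    _ = 𝟙 _ ⊗≫ ξ.cell ▷ ((B'.t ≫ A'.t) ≫ B'.t) ⊗≫
          A.t ◁ pairCell ζ ξ ▷ B'.t ⊗≫
          A.t ◁ ((b ▷ A.t ≫ R.t ◁ a ≫ R.mul) ▷ (V ≫ B'.t) ≫ R.t ◁ ζ.cell) ⊗≫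
          A.t ◁ (R.t ◁ b ≫ R.mul) ▷ V ⊗≫ (a ▷ R.t ≫ R.mul) ▷ V := by
      rw [hx]; bicategory
    _ = 𝟙 _ ⊗≫ ξ.cell ▷ ((B'.t ≫ A'.t) ≫ B'.t) ⊗≫
          A.t ◁ pairCell ζ ξ ▷ B'.t ⊗≫ A.t ◁ B.t ◁ A.t ◁ ζ.cell ⊗≫
          (𝟙 ((A.t ≫ B.t) ≫ (A.t ≫ B.t)) ⊗≫ A.t ◁ (b ▷ A.t ≫ R.t ◁ a ≫ R.mul) ▷ B.t ⊗≫
          A.t ◁ (R.t ◁ b ≫ R.mul) ⊗≫ a ▷ R.t ⊗≫ R.mul) ▷ V := by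
      rw [← whisker_exchange]; bicategory
    _ = 𝟙 _ ⊗≫ pairCell ξ ζ ▷ (A'.t ≫ B'.t) ⊗≫
          ((A.t ≫ B.t) ◁ pairCell ξ ζ ≫ (α_ _ _ _).inv ≫
          (factProj A B R a b ▷ (A.t ≫ B.t) ≫ R.t ◁ factProj A B R a b ≫ R.mul) ▷ V) := by
      rw [factProj_mul, pairCell, pairCell]; bicategory
    _ = 𝟙 _ ⊗≫ pairCell ξ ζ ▷ (A'.t ≫ B'.t) ⊗≫
          ((A.t ≫ B.t) ◁ pairCell ξ ζ ≫ factProj A B R a b ▷ ((A.t ≫ B.t) ≫ V)) ⊗≫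
          R.t ◁ factProj A B R a b ▷ V ⊗≫ R.mul ▷ V := by bicategory
    _ = 𝟙 _ ⊗≫ (pairCell ξ ζ ≫ factProj A B R a b ▷ V) ▷ (A'.t ≫ B'.t) ⊗≫
          R.t ◁ (pairCell ξ ζ ≫ factProj A B R a b ▷ V) ⊗≫ R.mul ▷ V := by
      rw [whisker_exchange]; bicategory
    _ = 𝟙 _ ⊗≫ V ◁ factProj A' B' R' a' b' ▷ (A'.t ≫ B'.t) ⊗≫
          (ρ ▷ (A'.t ≫ B'.t) ≫ (R.t ≫ V) ◁ factProj A' B' R' a' b') ⊗≫ R.t ◁ ρ ⊗≫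
          R.mul ▷ V := by
      rw [← hρ]; bicategory
    _ = _ := by rw [← whisker_exchange]; bicategory

lemma extension_unit
    {ξ : MonadHom A A' V} {ρ : V ≫ R'.t ⟶ R.t ≫ V}
    (h : IsMonadMap A R a) (h' : IsMonadMap A' R' a') (hρ : V ◁ a' ≫ ρ = ξ.cell ≫ a ▷ V) :
    (ρ_ V).inv ≫ V ◁ R'.unit ≫ ρ = (λ_ V).inv ≫ R.unit ▷ V := by
  rw [← h.unit, ← h'.unit, whiskerLeft_comp, Category.assoc, hρ, reassoc_of% ξ.unit,
    comp_whiskerRight]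

/-- As `π'` is a split epimorphism, a monad transformation for both factors is one for the
factorized monad. -/
lemma isMonadTrans_of_factProj {V' : X ⟶ X'} {ξ : MonadHom A A' V} {ζ : MonadHom B B' V}
    {ξ' : MonadHom A A' V'} {ζ' : MonadHom B B' V'} {ρ : MonadHom R R' V} {ρ' : MonadHom R R' V'}
    (h' : IsBilinFact A' B' R' a' b' i')
    (hρ : V ◁ factProj A' B' R' a' b' ≫ ρ.cell = pairCell ξ ζ ≫ factProj A B R a b ▷ V)
    (hρ' : V' ◁ factProj A' B' R' a' b' ≫ ρ'.cell = pairCell ξ' ζ' ≫ factProj A B R a b ▷ V')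
    {ω : V ⟶ V'} (hξ : IsMonadTrans ξ ξ' ω) (hζ : IsMonadTrans ζ ζ' ω) :
    IsMonadTrans ρ ρ' ω := by
  unfold IsMonadTrans at *
  have he : V ◁ i' ≫ V ◁ factProj A' B' R' a' b' = 𝟙 _ := by
    rw [← whiskerLeft_comp, h'.iota_proj, whiskerLeft_id]
  have : Epi (V ◁ factProj A' B' R' a' b') := (SplitEpi.mk _ he).epi
  rw [← cancel_epi (V ◁ factProj A' B' R' a' b')]
  calc
    _ = pairCell ξ ζ ≫ (factProj A B R a b ▷ V ≫ R.t ◁ ω) := by rw [reassoc_of% hρ]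
    _ = 𝟙 _ ⊗≫ ξ.cell ▷ B'.t ⊗≫ A.t ◁ (ζ.cell ≫ B.t ◁ ω) ⊗≫ factProj A B R a b ▷ V' := by
      rw [← whisker_exchange, pairCell]; bicategory
    _ = 𝟙 _ ⊗≫ (ξ.cell ≫ A.t ◁ ω) ▷ B'.t ⊗≫ A.t ◁ ζ'.cell ⊗≫ factProj A B R a b ▷ V' := by
      rw [hζ]; bicategory
    _ = ω ▷ (A'.t ≫ B'.t) ≫ pairCell ξ' ζ' ≫ factProj A B R a b ▷ V' := by
      rw [hξ, pairCell]; bicategory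
    _ = _ := by rw [← hρ', whisker_exchange_assoc]
/-- Monad morphisms of the two factors that are compatible with the weak distributive laws extend to
a monad morphism of the factorized monads. -/
def extension {ξ : MonadHom A A' V} {ζ : MonadHom B B' V}
    (h : IsBilinFact A B R a b i) (h' : IsBilinFact A' B' R' a' b' i')
    (H : IsWdlHom (factPsi A B R a b i) (factPsi A' B' R' a' b' i') ξ ζ) : MonadHom R R' V where
  cell := V ◁ i' ≫ pairCell ξ ζ ≫ factProj A B R a b ▷ V
  unit := extension_unit h.alpha h'.alpha
    (extension_comm_alpha h h' (factProj_iota_pairCell h h' H))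
  mul := extension_mul h h' (factProj_iota_pairCell h h' H) (crossing_iota_pairCell h h' H)
end

lemma Bf.Hom.factProj_comp_rho {P Q : Bf K} (f : Bf.Hom P Q) :
    f.V ◁ factProj Q.A Q.B Q.R Q.alpha Q.beta ≫ f.rho.cell =
      pairCell f.xi f.zeta ≫ factProj P.A P.B P.R P.alpha P.beta ▷ f.V := by
  rw [f.factProj_comm, pairCell]
  simp only [Category.assoc]

/-- The preimage in `Bf K` of a 1-cell between weak distributive laws of factorizations. -/
def Bf.homOfWdl {P Q : Bf K} (f : Wdl.Hom ((toWdl K).obj P) ((toWdl K).obj Q)) : Bf.Hom P Q where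
  V := f.V
  xi := f.xi
  zeta := f.zeta
  rho := extension P.isBilinFact Q.isBilinFact f.comm
  comm_alpha := extension_comm_alpha P.isBilinFact Q.isBilinFact
    (factProj_iota_pairCell P.isBilinFact Q.isBilinFact f.comm)
  comm_beta := extension_comm_beta P.isBilinFact Q.isBilinFact
    (factProj_iota_pairCell P.isBilinFact Q.isBilinFact f.comm)

lemma toWdl_mapFunctor_isEquivalence (P Q : Bf K) :
    ((toWdl K).mapFunctor P Q).IsEquivalence where
  faithful := ⟨fun h => Bf.hom₂_ext (congrArg Wdl.Hom₂.hom h)⟩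
  full := ⟨fun {f g} u => ⟨Bf.Hom₂.mk (Wdl.Hom₂.hom u) (Wdl.Hom₂.xi u) (Wdl.Hom₂.zeta u)
    (isMonadTrans_of_factProj Q.isBilinFact (Bf.Hom.factProj_comp_rho f)
      (Bf.Hom.factProj_comp_rho g) (Wdl.Hom₂.xi u) (Wdl.Hom₂.zeta u)), rfl⟩⟩
  essSurj := ⟨fun f => ⟨Bf.homOfWdl f, ⟨Iso.refl _⟩⟩⟩

end BilinFac

theorem theorem1p4 {K : Type u} [CategoryTheory.Bicategory.{w, v} K]
    (hK : ∀ X Y : K, CategoryTheory.IsIdempotentComplete (X ⟶ Y)) :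
    BilinFac.IsBiequivalence (BilinFac.toWdl K) where
  biessSurj Y := by
    obtain ⟨P, rfl⟩ := BilinFac.toWdl_obj_surjective (fun X => hK X X) Y
    exact ⟨P, ⟨Equivalence.id _⟩⟩
  homEquiv := BilinFac.toWdl_mapFunctor_isEquivalence
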